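/- Let $(E,\mathcal E)$ be a measurable space and $P$ a Markov kernel on it. For a measurable function $w:E\to[1,+\infty)$, let $\mathcal B_w$ be the Banach space of measurable $f:E\to\mathbb C$ with $\|f\|_w=\sup_E w^{-1}|f|<+\infty$. For a bounded measurable function $\chi:E\times E\to\mathbb C$ put $\|\chi\|=\sup_{E\times E}|\chi|$ and $P_\chi f(x)=\int_E f(y)\,\chi(x,y)\,P(x,dy)$. For a bounded operator $Q$ on $\mathcal B_w$, let $r^w(Q)$ be its spectral radius. The essential spectral radius $r_e^w(Q)$ is the infimum of $r^w(Q)$ and of the real numbers $\rho\ge 0$ for which $\mathcal B_w=F\oplus H$ with $Q$-invariant subspaces $F,H$ such that $H$ is closed and $r^w(Q|_H)<\rho$, $\dim F<+\infty$, and all eigenvalues of $Q|_F$ have modulus $\ge\rho$. The operator $Q$ is called quasi-compact if $r_e^w(Q)<r^w(Q)$. For a probability measure $\nu$ on $(E,\mathcal E)$, let $\mathcal H^{(w)}_\nu$ be the set of measurable $\alpha:E\times E\to[0,+\infty)$ such that the functions $\alpha^{(w)}(x,\cdot)=w(x)^{-1}\alpha(x,\cdot)w(\cdot)$, $x\in E$,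 are uniformly $\nu$-integrable, i.e. $\lim_{m\to+\infty}\sup_{x\in E}\int_{\{y:\,\alpha^{(w)}(x,y)\ge m\}}\alpha^{(w)}(x,y)\,d\nu(y)=0$; and let $T_{\nu,\alpha}(x,A)=\int_A\alpha(x,y)\,d\nu(y)$. **Theorem.** Assume that there is a non-empty set $C\in\mathcal E$ such that (a) there are a measurable $w:E\to[1,+\infty)$ and constants $r_1>1$, $\eta\ge 0$ with $Pw\le r_1^{-1}(w1_{C^c}+\eta 1_C)$; (b) there are $0<b\le 1$, a probability measure $\nu$ and $\alpha\in\mathcal H_\nu^{(w)}$ such that $T_{\nu,\alpha}$ is a Markov kernel and $P(x,A)\ge b\,1_C(x)\,T_{\nu,\alpha}(x,A)$ for all $x\in E$, $A\in\mathcal E$. Then $P$ acts as a bounded operator on $\mathcal B_w$, it is quasi-compact on $\mathcal B_w$, and $r^w(P)=1$. Moreover, let $P_0$ be the Markov kernel defined by $P_0(x,A)=\dfrac{P(x,A)-b1_C(x)T_{\nu,\alpha}(x,A)}{1-b1_C(x)}$ if $b<1$ or $x\notin C$, and $P_0(x,A)=1_A(x)$ if $b=1$ and $x\in C$. Let $(X_n)_{n\ge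 0}$ be the Markov chain with transition kernel $P$, let $E_y$ be the expectation for the chain started at $y$, let $\sigma_C=\inf\{n\ge 0: X_n\in C\}$, and for $0\le r\le r_1$ put $$h(r)=\sup_{x\in C}\int_E P_0(x,dy)\;r\,E_y[r^{\sigma_C}].$$ Then (i) $h(r_1)<+\infty$, and $r_b:=\sup\{r: 0\le r\le r_1,\ h(r)<\tfrac1{1-b}\}>1$ (with $\tfrac1{1-b}=+\infty$ if $b=1$); (ii) $r_e^w(P)\le r_b^{-1}$; (iii) for every bounded measurable $\chi:E\times E\to\mathbb C$, $P_\chi$ is a bounded operator on $\mathcal B_w$, and if $\|\chi\|\,r_b^{-1}<r^w(P_\chi)$, then $P_\chi$ is quasi-compact on $\mathcal B_w$ and $r_e^w(P_\chi)\le\|\chi\|\,r_b^{-1}$. -/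

import Mathlib

open MeasureTheory ProbabilityTheory Filter Topology
open scoped NNReal ENNReal

noncomputable section

namespace MarkovQuasiCompact

/-! ### Essential spectral radius -/

section EssentialSpectralRadius

variable {B : Type*} [NormedAddCommGroup B] [NormedSpace ℂ B]

/-- `B = F ⊕ H`, where `F` and `H` are `Q`-invariant, `H` is closed, the spectral radius of `Q|_H`
is `< ρ`, `F` is finite dimensional, and the eigenvalues of `Q|_F` have modulus `≥ ρ`. -/
structure IsSpectralSplitting (Q : B →L[ℂ] B) (ρ : ℝ≥0) (F H : Submodule ℂ B) : Prop where
  isCompl : IsCompl F H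
  isClosed : IsClosed (H : Set B)
  finiteDimensional : FiniteDimensional ℂ F
  mapsTo_F : ∀ f ∈ F, (Q : B →ₗ[ℂ] B) f ∈ F
  mapsTo_H : Set.MapsTo Q H H
  eigenvalue : ∀ z : ℂ,
    Module.End.HasEigenvalue ((Q : B →ₗ[ℂ] B).restrict mapsTo_F) z → ρ ≤ ‖z‖₊
  spectralRadius_lt : spectralRadius ℂ (Q.restrict mapsTo_H) < ρ

/-- The essential spectral radius: the infimum of the spectral radius of `Q` and of the numbers
`ρ ≥ 0` which admit a spectral splitting. -/
def essSpectralRadius (Q : B →L[ℂ] B) : ℝ≥0∞ :=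
  sInf (insert (spectralRadius ℂ Q)
    ((fun ρ : ℝ≥0 => (ρ : ℝ≥0∞)) '' {ρ : ℝ≥0 | ∃ F H, IsSpectralSplitting Q ρ F H}))

/-- `Q` is quasi-compact when its essential spectral radius is smaller than its spectral radius. -/
def IsQuasiCompact (Q : B →L[ℂ] B) : Prop :=
  essSpectralRadius Q < spectralRadius ℂ Q

end EssentialSpectralRadius

/-! ### The weighted space `𝓑_w` -/

/-- A measurable function `w : E → [1, ∞)`. -/
structure WeightFunction (E : Type*) [MeasurableSpace E] where
  toFun : E → ℝ≥0
  measurable' : Measurable toFun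
  one_le' : ∀ x, 1 ≤ toFun x

section WeightedSpace

variable {E : Type*} [MeasurableSpace E]

instance : CoeFun (WeightFunction E) (fun _ => E → ℝ≥0) := ⟨WeightFunction.toFun⟩

/-- The measurable functions `f : E → ℂ` with `sup_E w⁻¹ |f| < ∞`, as a vector space. -/
def weightedSubmodule (w : WeightFunction E) : Submodule ℂ (E → ℂ) where
  carrier := {f | Measurable f ∧ ∃ M : ℝ, ∀ x, ‖f x‖ / w x ≤ M}
  zero_mem' := ⟨measurable_const, 0, fun x => by simp⟩
  add_mem' := by
    rintro f g ⟨hf, M, hM⟩ ⟨hg, N, hN⟩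
    refine ⟨hf.add hg, M + N, fun x => ?_⟩
    calc ‖(f + g) x‖ / w x ≤ (‖f x‖ + ‖g x‖) / w x := by
          gcongr; exact norm_add_le _ _
      _ = ‖f x‖ / w x + ‖g x‖ / w x := add_div _ _ _
      _ ≤ M + N := add_le_add (hM x) (hN x)
  smul_mem' := by
    rintro c f ⟨hf, M, hM⟩
    refine ⟨hf.const_smul c, ‖c‖ * M, fun x => ?_⟩
    rw [Pi.smul_apply, norm_smul, mul_div_assoc]
    exact mul_le_mul_of_nonneg_left (hM x) (norm_nonneg c)

/-- The normed space `𝓑_w` of measurable functions `f : E → ℂ` with `sup_E w⁻¹ |f| < ∞`. -/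
def WeightedSpace (w : WeightFunction E) : Type _ := weightedSubmodule w

namespace WeightedSpace

variable {w : WeightFunction E}

instance : AddCommGroup (WeightedSpace w) := inferInstanceAs (AddCommGroup (weightedSubmodule w))

instance : Module ℂ (WeightedSpace w) := inferInstanceAs (Module ℂ (weightedSubmodule w))

instance : CoeFun (WeightedSpace w) (fun _ => E → ℂ) := ⟨fun f => f.1⟩

/-- `‖f‖_w = sup_E w⁻¹ |f|`. -/
instance : Norm (WeightedSpace w) := ⟨fun f => ⨆ x, ‖f x‖ / w x⟩

theorem norm_def (f : WeightedSpace w) : ‖f‖ = ⨆ x, ‖f x‖ / w x := rfl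

theorem bddAbove_range (f : WeightedSpace w) : BddAbove (Set.range fun x => ‖f x‖ / w x) := by
  obtain ⟨M, hM⟩ := f.2.2
  exact ⟨M, by rintro _ ⟨x, rfl⟩; exact hM x⟩

theorem div_le_norm (f : WeightedSpace w) (x : E) : ‖f x‖ / w x ≤ ‖f‖ :=
  le_ciSup f.bddAbove_range x

theorem weight_pos (w : WeightFunction E) (x : E) : (0 : ℝ) < w x := by
  exact_mod_cast lt_of_lt_of_le zero_lt_one (w.one_le' x)

theorem normedSpaceCore : NormedSpace.Core ℂ (WeightedSpace w) where
  norm_nonneg f := Real.iSup_nonneg fun x => by positivity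
  norm_smul c f := by
    rw [norm_def, norm_def, Real.mul_iSup_of_nonneg (norm_nonneg c)]
    refine iSup_congr fun x => ?_
    change ‖c * f x‖ / w x = _
    rw [norm_mul, mul_div_assoc]
  norm_triangle f g := by
    refine Real.iSup_le (fun x => ?_)
      (add_nonneg (Real.iSup_nonneg fun x => by positivity)
        (Real.iSup_nonneg fun x => by positivity))
    calc ‖f x + g x‖ / w x ≤ (‖f x‖ + ‖g x‖) / w x := by
          gcongr; exact norm_add_le _ _
      _ = ‖f x‖ / w x + ‖g x‖ / w x := add_div _ _ _
      _ ≤ ‖f‖ + ‖g‖ := add_le_add (div_le_norm f x) (div_le_norm g x)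
  norm_eq_zero_iff f := by
    constructor
    · intro h
      refine Subtype.ext (funext fun x => ?_)
      have h1 : ‖f x‖ / w x ≤ 0 := h ▸ div_le_norm f x
      have h2 : ‖f x‖ ≤ 0 := by
        have := (div_le_iff₀ (weight_pos w x)).1 h1
        simpa using this
      exact norm_le_zero_iff.1 h2
    · rintro rfl
      have h0 : ∀ x : E, ‖(0 : WeightedSpace w) x‖ / (w x : ℝ) = 0 := fun x => by
        change ‖(0 : ℂ)‖ / (w x : ℝ) = 0
        simp
      rw [norm_def]
      simp only [h0]
      exact Real.iSup_const_zero

instance : NormedAddCommGroup (WeightedSpace w) := NormedAddCommGroup.ofCore normedSpaceCore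

instance : NormedSpace ℂ (WeightedSpace w) := NormedSpace.ofCore normedSpaceCore

end WeightedSpace

/-- The bounded operator `T` of `𝓑_w` is the operator `Q_χ`,
`Q_χ f (x) = ∫ f(y) χ(x, y) Q(x, dy)`, all these integrals being absolutely convergent. -/
def IsKernelOperator {w : WeightFunction E} (Q : Kernel E E) (χ : E × E → ℂ)
    (T : WeightedSpace w →L[ℂ] WeightedSpace w) : Prop :=
  ∀ (f : WeightedSpace w) (x : E),
    Integrable (fun y => f y * χ (x, y)) (Q x) ∧ T f x = ∫ y, f y * χ (x, y) ∂(Q x)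

end WeightedSpace

/-! ### Absolutely continuous kernels -/

section AbsolutelyContinuousKernels

variable {E : Type*} [MeasurableSpace E]

/-- The positive measurable functions `α` on `E × E` such that the functions `α(x, ·)`, `x ∈ E`,
are uniformly `ν`-integrable. -/
def uniformlyIntegrableDensities (ν : Measure E) : Set (E × E → ℝ≥0) :=
  {α | Measurable α ∧
    Tendsto (fun m : ℝ≥0 => ⨆ x, ∫⁻ y in {y | m ≤ α (x, y)}, (α (x, y) : ℝ≥0∞) ∂ν)
      atTop (𝓝 0)}

/-- The class `ℋ_ν^{(w)}`: positive measurable functions `α` on `E × E` such that the functions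
`w(x)⁻¹ α(x, ·) w(·)`, `x ∈ E`, are uniformly `ν`-integrable. -/
def weightedDensities (w : WeightFunction E) (ν : Measure E) : Set (E × E → ℝ≥0) :=
  {α | Measurable α ∧
    (fun p : E × E => (w p.1)⁻¹ * α p * w p.2) ∈ uniformlyIntegrableDensities ν}

/-- The kernel `T_{ν,α}(x, A) = ∫_A α(x, y) dν(y)` (for measurable `α`). -/
def densityKernel (ν : Measure E) [SFinite ν] (α : E × E → ℝ≥0) : Kernel E E :=
  Kernel.withDensity (Kernel.const E ν) (fun x y => (α (x, y) : ℝ≥0∞))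

end AbsolutelyContinuousKernels

/-! ### Markov chains and hitting times -/

section HittingTimes

variable {E : Type*} [MeasurableSpace E]

/-- The law, on the space of trajectories, of the Markov chain with transition kernel `P`
started at `x`. -/
def chainLaw (P : Kernel E E) [IsMarkovKernel P] (x : E) : Measure (ℕ → E) :=
  Kernel.traj (X := fun _ => E)
    (fun n => P.comap (fun z : (i : Finset.Iic n) → E => z ⟨n, Finset.mem_Iic.2 le_rfl⟩)
      (measurable_pi_apply _)) 0 (fun _ => x)

/-- `σ_C = inf {n ≥ 0 : X_n ∈ C}` for the canonical process, equal to `⊤` if `C` is never hit. -/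
def hitTime (C : Set E) : (ℕ → E) → WithTop ℕ :=
  hittingAfter (fun (n : ℕ) (ω : ℕ → E) => ω n) C 0

/-- `r ^ n`, where `r ^ ∞ = lim_n r ^ n` (that is `0`, `1`, `∞` for `r < 1`, `r = 1`, `r > 1`). -/
def powTop (r : ℝ≥0∞) : WithTop ℕ → ℝ≥0∞
  | (n : ℕ) => r ^ n
  | ⊤ => limsup (fun n : ℕ => r ^ n) atTop

/-- `E_x[r ^ σ_C]` for the Markov chain with transition kernel `P`. -/
def hitGenFun (P : Kernel E E) [IsMarkovKernel P] (C : Set E) (r : ℝ≥0∞) (x : E) : ℝ≥0∞ :=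
  ∫⁻ ω, powTop r (hitTime C ω) ∂(chainLaw P x)

/-- `P₀` is the residual kernel of `P` with respect to `b 1_C T`:
`P₀(x, A) = (1 - b 1_C(x))⁻¹ (P(x, A) - b 1_C(x) T(x, A))` if `b < 1` or `x ∉ C`, and
`P₀(x, A) = 1_A(x)` if `b = 1` and `x ∈ C`. -/
def IsResidualKernel (P T : Kernel E E) (C : Set E) (b : ℝ≥0) (P₀ : Kernel E E) : Prop :=
  ∀ x, ∀ A, MeasurableSet A →
    ((b < 1 ∨ x ∉ C) →
      P₀ x A = (1 - (b : ℝ≥0∞) * C.indicator 1 x)⁻¹ * (P x A - b * C.indicator 1 x * T x A)) ∧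
    (b = 1 → x ∈ C → P₀ x A = A.indicator 1 x)

/-- `h(r) = sup_{x ∈ C} ∫ P₀(x, dy) r E_y[r ^ σ_C]`, where `E_y` refers to the chain with transition
kernel `P`. -/
def returnGenFun (P P₀ : Kernel E E) [IsMarkovKernel P] (C : Set E) (r : ℝ≥0∞) : ℝ≥0∞ :=
  ⨆ x ∈ C, ∫⁻ y, r * hitGenFun P C r y ∂(P₀ x)

/-- `r_b = sup {r : 0 ≤ r ≤ r₁, h(r) < 1 / (1 - b)}`, where `1 / (1 - b) = ∞` if `b = 1`. -/
def rateRadius (P P₀ : Kernel E E) [IsMarkovKernel P] (C : Set E) (b r₁ : ℝ≥0) : ℝ≥0∞ :=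
  sSup {r : ℝ≥0∞ | r ≤ r₁ ∧ returnGenFun P P₀ C r < (1 - (b : ℝ≥0∞))⁻¹}

end HittingTimes

end MarkovQuasiCompact

end

open MarkovQuasiCompact

namespace MarkovQuasiCompact

/-! ### Finite rank perturbations of invertible operators -/

section FiniteRankPerturbation

open Module

/-! Split `P = N + R`, where `N = b 1_C T_{ν,α}` and `R` is the residual part: `(1 - b) P₀` on `C`
and `P` off `C`. Twisting by `χ` gives `P_χ = N_χ + R_χ`. The bound on the essential spectral radius
rests on two facts.

Compactness of `N_χ` (`isApproximable_mul_mul`). By uniform integrability, `N_χ` is a norm limit of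
operators factoring through `L²(ν)` by way of a bounded weighted kernel. A bounded operator from a
Hilbert space into a weighted sup space becomes Hilbert-Schmidt when followed by the map to `L²(ν)`.
So `N_χ A N_χ` is a norm limit of finite rank operators for every bounded `A`.

Contraction of `R_χ` (`exists_supersolution`). Let `u(x) = E_x[r^σ_C]`. If `h(r) < 1/(1-b)`, a
suitable `φ = w + c u` is comparable to `w` and satisfies `r Rφ ≤ φ`. Off `C` this is the drift
condition and the first-step equation for `u`; on `C` it is the bound on `h(r)`. Hence `‖R_χ^n‖ =
O(κ^n)` whenever `κ r ≥ ‖χ‖`.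

In the expansion of `(N_χ + R_χ)^n`, words with two factors `N_χ` are approximable; the others have
total norm `O(n κ^n)`. So for `ρ > κ` some power is `K + R'` with `K` of finite rank and `‖R'‖`
small against `ρ^n` (`exists_isSpectralSplitting_add`). Riesz theory for `A = K + R'` then gives the
splitting: for `|μ| ≥ ρ^n`, `A - μ` is invertible plus finite rank, hence of index zero, and some
product `S` of such operators has a kernel that no further factor enlarges. The space is `ker S ⊕
range S` (`exists_isSpectralSplitting`).

The spectral radius of `P` is `1` because constants are fixed and the drift bounds the powers of
`P`. Finally `r_b > 1` because convexity of powers gives `h(1 - t + t r₁) ≤ 1 + t h(r₁)`, while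
`1/(1-b) > 1`. -/

theorem finrank_quotient_range_one_add {k V : Type*} [Field k] [AddCommGroup V] [Module k V]
    (C : V →ₗ[k] V) [FiniteDimensional k C.range] :
    FiniteDimensional k (1 + C).ker ∧ FiniteDimensional k (V ⧸ (1 + C).range) ∧
      finrank k (V ⧸ (1 + C).range) = finrank k (1 + C).ker := by
  set L : V →ₗ[k] V := 1 + C with hL
  set W := C.range with hW
  have hLx : ∀ x, L x = x + C x := fun x => rfl
  have hLW : ∀ x ∈ W, L x ∈ W := fun x hx => by
    rw [hLx]; exact W.add_mem hx ⟨x, rfl⟩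
  -- Modulo `W` the map `L` is the identity, so its kernel and cokernel are those of its restriction
  -- `g` to the finite-dimensional space `W`, where rank-nullity applies.
  have hker : ∀ x, L x ∈ W → x ∈ W := fun x hx => by
    have : x = L x - C x := by rw [hLx]; abel
    rw [this]; exact W.sub_mem hx ⟨x, rfl⟩
  have hkerle : L.ker ≤ W := fun x hx => hker x (by rw [LinearMap.mem_ker.1 hx]; exact W.zero_mem)
  have hfin : FiniteDimensional k L.ker := Submodule.finiteDimensional_of_le hkerle
  let g : W →ₗ[k] W := L.restrict hLW
  let p : W →ₗ[k] V ⧸ L.range := L.range.mkQ ∘ₗ W.subtype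
  have hp : Function.Surjective p := by
    intro q
    obtain ⟨x, rfl⟩ := L.range.mkQ_surjective q
    refine ⟨⟨-C x, W.neg_mem ⟨x, rfl⟩⟩, ?_⟩
    change L.range.mkQ (-C x) = L.range.mkQ x
    rw [← sub_eq_zero, ← map_sub, ← LinearMap.mem_ker, Submodule.ker_mkQ]
    exact ⟨-x, by rw [hLx, map_neg]; abel⟩
  have hpker : p.ker = g.range := by
    ext ⟨x, hx⟩
    rw [LinearMap.mem_ker]
    change L.range.mkQ x = 0 ↔ _
    rw [← LinearMap.mem_ker, Submodule.ker_mkQ]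
    constructor
    · rintro ⟨y, rfl⟩
      exact ⟨⟨y, hker y hx⟩, rfl⟩
    · rintro ⟨y, hy⟩
      exact ⟨y, congrArg Subtype.val hy⟩
  have e1 : (W ⧸ p.ker) ≃ₗ[k] V ⧸ L.range := p.quotKerEquivOfSurjective hp
  have e2 : g.ker ≃ₗ[k] L.ker :=
    { toFun := fun x => ⟨x.1.1, congrArg Subtype.val x.2⟩
      invFun := fun x => ⟨⟨x.1, hkerle x.2⟩, Subtype.ext x.2⟩
      map_add' := fun _ _ => rfl
      map_smul' := fun _ _ => rfl
      left_inv := fun _ => rfl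
      right_inv := fun _ => rfl }
  refine ⟨hfin, e1.finiteDimensional, ?_⟩
  rw [← e1.finrank_eq, ← e2.finrank_eq, hpker]
  have h1 := g.range.finrank_quotient_add_finrank
  have h2 := g.finrank_range_add_finrank_ker
  omega

variable {B : Type*} [NormedAddCommGroup B] [NormedSpace ℂ B]

/-- `S` is the sum of an invertible operator and of an operator of finite rank. -/
def IsUnitAddFiniteRank (S : B →L[ℂ] B) : Prop :=
  ∃ U C : B →L[ℂ] B, IsUnit U ∧ FiniteDimensional ℂ C.range ∧ S = U + C

theorem finiteDimensional_range_add {C D : B →L[ℂ] B} (hC : FiniteDimensional ℂ C.range)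
    (hD : FiniteDimensional ℂ D.range) : FiniteDimensional ℂ (C + D).range := by
  refine Submodule.finiteDimensional_of_le (S₂ := C.range ⊔ D.range) ?_
  rintro _ ⟨x, rfl⟩
  exact Submodule.add_mem_sup ⟨x, rfl⟩ ⟨x, rfl⟩

theorem finiteDimensional_range_comp_left {X Y Z : Type*} [NormedAddCommGroup X]
    [NormedSpace ℂ X] [NormedAddCommGroup Y] [NormedSpace ℂ Y] [NormedAddCommGroup Z]
    [NormedSpace ℂ Z] (D : Y →L[ℂ] Z) {C : X →L[ℂ] Y} (hC : FiniteDimensional ℂ C.range) :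
    FiniteDimensional ℂ (D ∘L C).range := by
  have : (D ∘L C).range = C.range.map (D : Y →ₗ[ℂ] Z) := by
    ext x; simp
  rw [this]; infer_instance

theorem finiteDimensional_range_comp_right {X Y Z : Type*} [NormedAddCommGroup X]
    [NormedSpace ℂ X] [NormedAddCommGroup Y] [NormedSpace ℂ Y] [NormedAddCommGroup Z]
    [NormedSpace ℂ Z] {D : Y →L[ℂ] Z} (hD : FiniteDimensional ℂ D.range) (C : X →L[ℂ] Y) :
    FiniteDimensional ℂ (D ∘L C).range := by
  refine Submodule.finiteDimensional_of_le (S₂ := D.range) ?_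
  rintro _ ⟨x, rfl⟩
  exact ⟨C x, rfl⟩

namespace IsUnitAddFiniteRank

theorem one : IsUnitAddFiniteRank (1 : B →L[ℂ] B) := by
  refine ⟨1, 0, isUnit_one, ?_, (add_zero _).symm⟩
  have : (0 : B →L[ℂ] B).range = ⊥ := by ext; simp
  rw [this]; infer_instance

theorem mul {S T : B →L[ℂ] B} (hS : IsUnitAddFiniteRank S) (hT : IsUnitAddFiniteRank T) :
    IsUnitAddFiniteRank (S * T) := by
  obtain ⟨U, C, hU, hC, rfl⟩ := hS
  obtain ⟨U', C', hU', hC', rfl⟩ := hT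
  refine ⟨U * U', U * C' + C * (U' + C'), hU.mul hU', ?_, by noncomm_ring⟩
  exact finiteDimensional_range_add (finiteDimensional_range_comp_left U hC')
    (finiteDimensional_range_comp_right hC _)

/-- Factor `U + C = U (1 + U⁻¹C)`: the invertible factor `U` changes neither the kernel nor the
codimension of the range. -/
theorem index_zero {S : B →L[ℂ] B} (hS : IsUnitAddFiniteRank S) :
    FiniteDimensional ℂ S.ker ∧ FiniteDimensional ℂ (B ⧸ S.range) ∧
      finrank ℂ (B ⧸ S.range) = finrank ℂ S.ker := by
  obtain ⟨_, C, ⟨U, rfl⟩, hC, rfl⟩ := hS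
  set L : B →L[ℂ] B := ((U⁻¹ : (B →L[ℂ] B)ˣ) : B →L[ℂ] B) ∘L C
  have hL : FiniteDimensional ℂ L.range := finiteDimensional_range_comp_left _ hC
  let e : B ≃L[ℂ] B := ContinuousLinearEquiv.ofUnit U
  have he : ∀ x, e x = (U : B →L[ℂ] B) x := fun _ => rfl
  have hmul : ∀ x, ((U : B →L[ℂ] B) + C) x = e ((1 + (L : B →ₗ[ℂ] B)) x) := by
    intro x
    rw [he]
    have : (U : B →L[ℂ] B) (((U⁻¹ : (B →L[ℂ] B)ˣ) : B →L[ℂ] B) (C x)) = C x := by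
      rw [← mul_apply_eq_comp, Units.mul_inv, one_apply_eq_self]
    simp [L, this]
  obtain ⟨h1, h2, h3⟩ := finrank_quotient_range_one_add (L : B →ₗ[ℂ] B)
  have hker : ((U : B →L[ℂ] B) + C).ker = (1 + (L : B →ₗ[ℂ] B)).ker := by
    ext x
    rw [LinearMap.mem_ker, LinearMap.mem_ker]
    change ((U : B →L[ℂ] B) + C) x = 0 ↔ _
    rw [hmul, e.map_eq_zero_iff]
  have hran : (1 + (L : B →ₗ[ℂ] B)).range.map (e.toLinearEquiv : B →ₗ[ℂ] B)
      = ((U : B →L[ℂ] B) + C).range := by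
    ext x
    constructor
    · rintro ⟨_, ⟨y, rfl⟩, rfl⟩
      exact ⟨y, hmul y⟩
    · rintro ⟨y, rfl⟩
      exact ⟨_, ⟨y, rfl⟩, (hmul y).symm⟩
  have e' := Submodule.Quotient.equiv _ _ e.toLinearEquiv hran
  rw [hker]
  exact ⟨h1, e'.finiteDimensional, e'.finrank_eq.symm.trans h3⟩

/-- On `ker C`, which is closed of finite codimension, `U + C` agrees with the homeomorphism `U`.
The image of `ker C` is therefore closed, and the whole range exceeds it by finitely many
dimensions. -/
theorem isClosed_range {S : B →L[ℂ] B} (hS : IsUnitAddFiniteRank S) :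
    IsClosed (S.range : Set B) := by
  obtain ⟨_, C, ⟨U, rfl⟩, hC, rfl⟩ := hS
  let e : B ≃L[ℂ] B := ContinuousLinearEquiv.ofUnit U
  have hfin : FiniteDimensional ℂ (B ⧸ C.ker) :=
    (C : B →ₗ[ℂ] B).quotKerEquivRange.symm.finiteDimensional
  have : C.ker.CoFG := hfin
  have hmap : C.ker.map (((U : B →L[ℂ] B) + C : B →L[ℂ] B) : B →ₗ[ℂ] B)
      = C.ker.map (e.toLinearEquiv : B →ₗ[ℂ] B) := by
    refine SetLike.coe_injective ?_
    refine Set.image_congr fun x hx => ?_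
    have : C x = 0 := hx
    change (U : B →L[ℂ] B) x + C x = (U : B →L[ℂ] B) x
    rw [this, add_zero]
  refine LinearMap.isClosed_range_of_isClosed_map_of_finiteDimensional_quotient (s := C.ker) ?_
  rw [hmap]
  exact e.toHomeomorph.isClosedMap _ C.isClosed_ker

/-- Index zero turns equal kernels into equal finite codimensions, and nested subspaces of the same
finite codimension coincide. -/
theorem range_eq_of_ker_eq {S T : B →L[ℂ] B} (hS : IsUnitAddFiniteRank S)
    (hT : IsUnitAddFiniteRank T) (hker : S.ker = T.ker) (hran : S.range ≤ T.range) :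
    S.range = T.range := by
  obtain ⟨-, hS2, hS3⟩ := hS.index_zero
  obtain ⟨-, hT2, hT3⟩ := hT.index_zero
  have heq : finrank ℂ (B ⧸ S.range) = finrank ℂ (B ⧸ T.range) := by rw [hS3, hT3, hker]
  have hsurj : Function.Surjective (Submodule.factor hran) := Submodule.factor_surjective hran
  have hinj := (LinearMap.injective_iff_surjective_of_finrank_eq_finrank heq).2 hsurj
  refine le_antisymm hran fun x hx => ?_
  rw [← Submodule.Quotient.mk_eq_zero]
  refine hinj ?_
  rw [map_zero]
  exact (Submodule.Quotient.mk_eq_zero _).2 hx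

end IsUnitAddFiniteRank

end FiniteRankPerturbation

/-! ### Spectral splittings of finite rank perturbations of operators of small norm -/

section Splitting

variable {B : Type*} [NormedAddCommGroup B] [NormedSpace ℂ B]

/-- F. Riesz's argument: there is no infinite chain of generalized eigenspaces of `K + R`. -/
theorem not_strictMono_generalized_eigenspaces {K R : B →L[ℂ] B}
    (hK : FiniteDimensional ℂ K.range) {s : ℝ} (hR : 4 * ‖R‖ < s)
    {F : ℕ → Submodule ℂ B} (hclosed : ∀ n, IsClosed (F n : Set B)) (hF : ∀ n, F n < F (n + 1))
    (hinv : ∀ n, ∀ x ∈ F n, (K + R) x ∈ F n) {μ : ℕ → ℂ} (hμ : ∀ n, s ≤ ‖μ n‖)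
    (heig : ∀ n, ∀ x ∈ F (n + 1), (K + R) x - μ n • x ∈ F n) : False := by
  have hmono : Monotone F := monotone_nat_of_le_succ fun n => (hF n).le
  have hs : 0 < s := lt_of_le_of_lt (by positivity) hR
  -- Riesz's lemma with `5/4 < 3/2`: almost orthogonal vectors `u n` in `F (n + 1)`, at distance at
  -- least `1` from `F n`.
  have hex : ∀ n, ∃ x ∈ F (n + 1), ‖x‖ ≤ 3 / 2 ∧ ∀ y ∈ F n, 1 ≤ ‖x - y‖ := by
    intro n
    have h1 : IsClosed (((F n).comap (F (n + 1)).subtype : Submodule ℂ (F (n + 1))) :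
        Set (F (n + 1))) := (hclosed n).preimage continuous_subtype_val
    obtain ⟨x, hx, hx'⟩ := SetLike.exists_of_lt (hF n)
    obtain ⟨⟨u, hu⟩, hun, huy⟩ := riesz_lemma_of_norm_lt (𝕜 := ℂ) (c := (5 / 4 : ℂ)) (R := 3 / 2)
      (by norm_num) (by norm_num) h1 ⟨⟨x, hx⟩, hx'⟩
    exact ⟨u, hu, hun, fun y hy => huy ⟨y, (hF n).le hy⟩ hy⟩
  choose u hu hun huy using hex
  -- The images are `s`-separated: their difference is `μ j` times `u j` minus an element of `F j`.
  have hsep : ∀ i j, i < j → s ≤ ‖(K + R) (u j) - (K + R) (u i)‖ := by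
    intro i j hij
    have hμ0 : μ j ≠ 0 := fun h => by
      have := hμ j
      rw [h, norm_zero] at this
      exact absurd hs this.not_gt
    have hui : u i ∈ F j := hmono (Nat.succ_le_of_lt hij) (hu i)
    set y := (K + R) (u i) - ((K + R) (u j) - μ j • u j) with hy
    have hyF : y ∈ F j := (F j).sub_mem (hinv j _ hui) (heig j _ (hu j))
    have hdiff : (K + R) (u j) - (K + R) (u i) = μ j • (u j - (μ j)⁻¹ • y) := by
      rw [smul_sub, smul_smul, mul_inv_cancel₀ hμ0, one_smul, hy]; abel
    rw [hdiff, norm_smul]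
    have := huy j _ ((F j).smul_mem (μ j)⁻¹ hyF)
    nlinarith [hμ j]
  have : ProperSpace K.range := FiniteDimensional.proper ℂ K.range
  let v : ℕ → K.range := fun n => ⟨K (u n), ⟨u n, rfl⟩⟩
  have hv : ∀ n, v n ∈ Metric.closedBall (0 : K.range) (‖K‖ * (3 / 2)) := by
    intro n
    rw [mem_closedBall_zero_iff]
    exact (K.le_opNorm (u n)).trans (mul_le_mul_of_nonneg_left (hun n) (norm_nonneg _))
  obtain ⟨a, -, φ, hφ, hlim⟩ :=
    tendsto_subseq_of_bounded Metric.isBounded_closedBall hv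
  -- Along a subsequence the `K`-parts differ by less than `s/4`, and the `R`-parts by at most `3‖R‖
  -- < 3s/4`. The total is below `s`, against the separation; hence the factor `4` in the
  -- hypothesis.
  obtain ⟨N, hN⟩ := Metric.cauchySeq_iff.1 hlim.cauchySeq (s / 4) (by positivity)
  have h1 := hN (N + 1) (by omega) N le_rfl
  have h2 := hsep (φ N) (φ (N + 1)) (hφ (Nat.lt_succ_self N))
  have h3 : ‖K (u (φ (N + 1))) - K (u (φ N))‖ < s / 4 := by
    rw [dist_eq_norm] at h1; exact h1
  have h4 : ‖R (u (φ (N + 1))) - R (u (φ N))‖ ≤ ‖R‖ * 3 := by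
    rw [← map_sub]
    refine (R.le_opNorm _).trans (mul_le_mul_of_nonneg_left ?_ (norm_nonneg _))
    refine (norm_sub_le _ _).trans ?_
    linarith [hun (φ (N + 1)), hun (φ N)]
  have h5 : (K + R) (u (φ (N + 1))) - (K + R) (u (φ N))
      = (K (u (φ (N + 1))) - K (u (φ N))) + (R (u (φ (N + 1))) - R (u (φ N))) := by
    simp only [add_apply]; abel
  rw [h5] at h2
  have h6 := norm_add_le (K (u (φ (N + 1))) - K (u (φ N))) (R (u (φ (N + 1))) - R (u (φ N)))
  linarith

/-- The products of operators `A - μ` with `s ≤ |μ|`. -/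
def shiftProducts (A : B →L[ℂ] B) (s : ℝ) : Submonoid (B →L[ℂ] B) :=
  Submonoid.closure {S | ∃ μ : ℂ, s ≤ ‖μ‖ ∧ S = A - μ • 1}

theorem commute_of_mem_shiftProducts {A X S : B →L[ℂ] B} {s : ℝ} (hX : Commute X A)
    (hS : S ∈ shiftProducts A s) : Commute X S := by
  induction hS using Submonoid.closure_induction with
  | mem S hS =>
    obtain ⟨μ, -, rfl⟩ := hS
    exact hX.sub_right ((Commute.one_right X).smul_right μ)
  | one => exact Commute.one_right X
  | mul S T _ _ hS hT => exact hS.mul_right hT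

/-- Each factor is `(R - μ) + K`, and `R - μ` is invertible because `‖R‖ < s ≤ |μ|`. -/
theorem isUnitAddFiniteRank_of_mem_shiftProducts [CompleteSpace B] {K R S : B →L[ℂ] B} {s : ℝ}
    (hK : FiniteDimensional ℂ K.range) (hR : ‖R‖ < s) (hS : S ∈ shiftProducts (K + R) s) :
    IsUnitAddFiniteRank S := by
  induction hS using Submonoid.closure_induction with
  | mem S hS =>
    obtain ⟨μ, hμ, rfl⟩ := hS
    refine ⟨R - μ • 1, K, ?_, hK, by abel⟩
    have h : μ ∈ resolventSet ℂ R := by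
      refine spectrum.mem_resolventSet_of_norm_lt_mul ?_
      refine lt_of_le_of_lt ?_ (hR.trans_le hμ)
      calc ‖R‖ * ‖(1 : B →L[ℂ] B)‖ ≤ ‖R‖ * 1 :=
            mul_le_mul_of_nonneg_left ContinuousLinearMap.norm_id_le (norm_nonneg _)
        _ = ‖R‖ := mul_one _
    rw [spectrum.mem_resolventSet_iff, Algebra.algebraMap_eq_smul_one] at h
    rw [← neg_sub]; exact h.neg
  | one => exact .one
  | mul S T _ _ hS hT => exact hS.mul hT

/-- On an eigenvector of `A`, a product of factors `A - z` acts as the scalar `∏ (μ - z)`, which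
vanishes only if `μ` is one of the `z`. -/
theorem eigenvalue_ge_of_mem_shiftProducts {A S : B →L[ℂ] B} {s : ℝ}
    (hS : S ∈ shiftProducts A s) {x : B} {μ : ℂ} (hx : A x = μ • x) (hx0 : x ≠ 0)
    (hSx : S x = 0) : s ≤ ‖μ‖ := by
  have key : ∃ c : ℂ, S x = c • x ∧ (c = 0 → s ≤ ‖μ‖) := by
    clear hSx
    induction hS using Submonoid.closure_induction with
    | mem S hS =>
      obtain ⟨z, hz, rfl⟩ := hS
      refine ⟨μ - z, by simp [hx, sub_smul], fun h => ?_⟩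
      rw [sub_eq_zero.1 h]; exact hz
    | one => exact ⟨1, by simp, fun h => absurd h one_ne_zero⟩
    | mul S T _ _ hS hT =>
      obtain ⟨c, hc, hc'⟩ := hS
      obtain ⟨d, hd, hd'⟩ := hT
      refine ⟨d * c, by simp [hc, hd, smul_smul], fun h => ?_⟩
      exact (mul_eq_zero.1 h).elim hd' hc'
  obtain ⟨c, hc, hc'⟩ := key
  refine hc' ?_
  rw [hc] at hSx
  exact (smul_eq_zero.1 hSx).resolve_right hx0

/-- If every product could have its kernel enlarged by one more factor, iterating would give an
infinite strictly increasing chain of kernels, which Riesz's argument forbids. Stability under one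
factor extends to all products because everything commutes. -/
theorem exists_maximal_ker_shiftProducts {K R : B →L[ℂ] B}
    (hK : FiniteDimensional ℂ K.range) {s : ℝ} (hR : 4 * ‖R‖ < s) :
    ∃ S ∈ shiftProducts (K + R) s, ∀ T ∈ shiftProducts (K + R) s, (T * S).ker = S.ker := by
  set A := K + R with hA
  have step : ∃ S ∈ shiftProducts A s, ∀ μ : ℂ, s ≤ ‖μ‖ → ((A - μ • 1) * S).ker = S.ker := by
    by_contra! hcon
    choose! μ hμ hne using hcon
    have hmem : ∀ S ∈ shiftProducts A s, (A - μ S • 1) * S ∈ shiftProducts A s := fun S hS =>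
      mul_mem (Submonoid.subset_closure ⟨μ S, hμ S hS, rfl⟩) hS
    let step : shiftProducts A s → shiftProducts A s := fun S => ⟨(A - μ S • 1) * S, hmem S S.2⟩
    let S : ℕ → shiftProducts A s := fun n => step^[n] 1
    have hSsucc : ∀ n, ((S (n + 1) : shiftProducts A s) : B →L[ℂ] B)
        = (A - μ (S n) • 1) * (S n : B →L[ℂ] B) := fun n => by
      change ((step^[n + 1] 1 : shiftProducts A s) : B →L[ℂ] B) = _
      rw [Function.iterate_succ_apply']
    refine not_strictMono_generalized_eigenspaces hK hR
      (F := fun n => (S n : B →L[ℂ] B).ker) (μ := fun n => μ (S n))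
      (fun n => (S n : B →L[ℂ] B).isClosed_ker) ?_ ?_ (fun n => hμ _ (S n).2) ?_
    · intro n
      refine lt_of_le_of_ne ?_ ?_
      · intro x hx
        have hx' : (S n : B →L[ℂ] B) x = 0 := hx
        change (S (n + 1) : B →L[ℂ] B) x = 0
        rw [hSsucc, mul_apply_eq_comp, hx', map_zero]
      · rw [hSsucc]; exact (hne _ (S n).2).symm
    · intro n x hx
      have hx' : (S n : B →L[ℂ] B) x = 0 := hx
      have hc := commute_of_mem_shiftProducts (Commute.refl A) (S n).2
      change (S n : B →L[ℂ] B) (A x) = 0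
      rw [← mul_apply_eq_comp, ← hc.eq, mul_apply_eq_comp, hx', map_zero]
    · intro n x hx
      have hx' : (S (n + 1) : B →L[ℂ] B) x = 0 := hx
      have hc : Commute (A - μ (S n) • 1) (S n : B →L[ℂ] B) :=
        commute_of_mem_shiftProducts ((Commute.refl A).sub_left
          ((Commute.one_left A).smul_left _)) (S n).2
      rw [hSsucc, hc.eq] at hx'
      exact hx'
  obtain ⟨S, hS, hmax⟩ := step
  refine ⟨S, hS, fun T hT => ?_⟩
  induction hT using Submonoid.closure_induction with
  | mem T hT => obtain ⟨μ, hμ, rfl⟩ := hT; exact hmax μ hμ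
  | one => rw [one_mul]
  | mul T T' hT _ ih ih' =>
    have hc : Commute T' S := by
      refine commute_of_mem_shiftProducts ?_ hS
      exact (commute_of_mem_shiftProducts (Commute.refl A) ‹_›).symm
    refine le_antisymm (fun x hx => ?_) (fun x hx => ?_)
    · have hx' : (T * T' * S) x = 0 := hx
      rw [mul_assoc, hc.eq, ← mul_assoc, mul_apply_eq_comp] at hx'
      have h1 : T' x ∈ (T * S).ker := hx'
      rw [ih] at h1
      have h2 : S (T' x) = 0 := h1
      rw [← ih']
      change (T' * S) x = 0
      rw [hc.eq]; exact h2
    · have hx' : S x = 0 := hx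
      change (T * T' * S) x = 0
      rw [mul_apply_eq_comp, hx', map_zero]

/-- If `z` is in the spectrum of `T`, then `z ^ n` is in that of `T ^ n`. The strict bound uses that
the spectral radius is attained, which needs a nonempty spectrum; the zero space is treated apart
since the complement `H` of the splitting may be zero. -/
theorem spectralRadius_lt_of_isUnit_pow_sub_pow [CompleteSpace B] (T : B →L[ℂ] B) {ρ : ℝ≥0}
    (hρ : 0 < ρ) (n : ℕ)
    (h : ∀ z : ℂ, ρ ≤ ‖z‖₊ → IsUnit (algebraMap ℂ (B →L[ℂ] B) (z ^ n) - T ^ n)) :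
    spectralRadius ℂ T < ρ := by
  rcases subsingleton_or_nontrivial B with hsub | hnon
  · have h0 : T = 0 := ContinuousLinearMap.ext fun x => Subsingleton.elim _ _
    rw [h0, spectrum.spectralRadius_zero]
    exact_mod_cast hρ
  · refine spectrum.spectralRadius_lt_of_forall_lt _ fun z hz => ?_
    by_contra! hle
    exact spectrum.pow_mem_pow T n hz (h z hle)

/-- Take `F = ker S` and `H = range S` for `S` with maximal kernel. `ker S² = ker S` makes the
intersection trivial, and index zero gives `range S² = range S`, so the sum is everything. On `H`
every `A - z^n` with `|z| ≥ ρ` is bijective. -/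
theorem exists_isSpectralSplitting [CompleteSpace B] {Q K R : B →L[ℂ] B} {n : ℕ} (hn : n ≠ 0)
    (hQ : Q ^ n = K + R) (hK : FiniteDimensional ℂ K.range) {ρ : ℝ≥0}
    (hR : 4 * ‖R‖ < (ρ : ℝ) ^ n) : ∃ F H, IsSpectralSplitting Q ρ F H := by
  set A := K + R with hA
  set s : ℝ := (ρ : ℝ) ^ n with hs
  have hR' : ‖R‖ < s := by linarith [norm_nonneg R]
  have hs0 : 0 < s := lt_of_le_of_lt (norm_nonneg R) hR'
  have hρ0 : 0 < ρ := by
    rcases eq_or_ne ρ 0 with h | h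
    · rw [hs, h, NNReal.coe_zero, zero_pow hn] at hs0; exact absurd hs0 (lt_irrefl _)
    · exact pos_iff_ne_zero.2 h
  obtain ⟨S, hS, hmax⟩ := exists_maximal_ker_shiftProducts hK hR
  have hfr : ∀ {T}, T ∈ shiftProducts A s → IsUnitAddFiniteRank T := fun hT =>
    isUnitAddFiniteRank_of_mem_shiftProducts hK hR' hT
  have hQA : Commute Q A := by rw [← hQ]; exact (Commute.refl Q).pow_right n
  have hQS : Commute Q S := commute_of_mem_shiftProducts hQA hS
  -- Maximality of the kernel becomes minimality of the range, through index zero.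
  have hran : ∀ {T}, T ∈ shiftProducts A s → (S * T).range = S.range := by
    intro T hT
    refine (hfr (mul_mem hS hT)).range_eq_of_ker_eq (hfr hS) ?_ ?_
    · have hc : Commute S T := by
        refine commute_of_mem_shiftProducts ?_ hT
        exact (commute_of_mem_shiftProducts (Commute.refl A) hS).symm
      rw [hc.eq, hmax T hT]
    · rintro _ ⟨x, rfl⟩
      exact ⟨T x, rfl⟩
  have hcompl : IsCompl S.ker S.range := by
    refine IsCompl.of_eq ?_ ?_
    · refine (Submodule.eq_bot_iff _).2 ?_
      rintro x ⟨hx, y, rfl⟩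
      have h1 : y ∈ (S * S).ker := hx
      rw [hmax S hS] at h1
      exact h1
    · refine (Submodule.eq_top_iff').2 fun x => ?_
      have h1 : S x ∈ (S * S).range := by rw [hran hS]; exact ⟨x, rfl⟩
      obtain ⟨y, hy⟩ := h1
      have hy' : S (S y) = S x := hy
      have : x = (x - S y) + S y := by abel
      rw [this]
      refine Submodule.add_mem_sup ?_ ⟨y, rfl⟩
      change S (x - S y) = 0
      rw [map_sub, hy', sub_self]
  have hmapF : ∀ f ∈ S.ker, (Q : B →ₗ[ℂ] B) f ∈ S.ker := by
    intro f hf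
    have hf' : S f = 0 := hf
    change (S * Q) f = 0
    rw [← hQS.eq, mul_apply_eq_comp, hf', map_zero]
  have hmapH : Set.MapsTo Q S.range S.range := by
    rintro _ ⟨x, rfl⟩
    exact ⟨Q x, (congrArg (fun T : B →L[ℂ] B => T x) hQS.eq).symm⟩
  have hclosed := (hfr hS).isClosed_range
  refine ⟨S.ker, S.range, ⟨hcompl, hclosed, (hfr hS).index_zero.1, hmapF, hmapH, ?_, ?_⟩⟩
  · intro z hz
    obtain ⟨⟨v, hv⟩, hvz⟩ := hz.exists_hasEigenvector
    have hv0 : v ≠ 0 := fun h => hvz.2 (Subtype.ext h)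
    have hQv : Q v = z • v := congrArg Subtype.val hvz.apply_eq_smul
    have hAv : A v = z ^ n • v := by
      rw [← hQ]
      clear * - hQv
      induction n with
      | zero => simp
      | succ n ih =>
        rw [pow_succ, mul_apply_eq_comp, hQv, map_smul, ih, smul_smul, pow_succ,
          mul_comm]
    have := eigenvalue_ge_of_mem_shiftProducts hS hAv hv0 hv
    rw [norm_pow] at this
    exact_mod_cast (pow_le_pow_iff_left₀ ρ.coe_nonneg (norm_nonneg z) hn).1 this
  · have : CompleteSpace S.range := hclosed.completeSpace_coe
    refine spectralRadius_lt_of_isUnit_pow_sub_pow _ hρ0 n fun z hle => ?_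
    have hzs : s ≤ ‖z ^ n‖ := by
      rw [norm_pow]; exact pow_le_pow_left₀ ρ.coe_nonneg hle n
    have hpow : ∀ m : ℕ, ∀ x : S.range, (((Q.restrict hmapH) ^ m) x : B) = (Q ^ m) x := by
      intro m
      induction m with
      | zero => intro x; rfl
      | succ m ih =>
        intro x
        rw [pow_succ, mul_apply_eq_comp, ih, pow_succ]
        rfl
    have hA' : A - z ^ n • 1 ∈ shiftProducts A s := Submonoid.subset_closure ⟨z ^ n, hzs, rfl⟩
    have hval : ∀ x : S.range, (((algebraMap ℂ (S.range →L[ℂ] S.range)) (z ^ n)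
        - (Q.restrict hmapH) ^ n) x : B) = -(A - z ^ n • 1) (x : B) := by
      intro x
      rw [Algebra.algebraMap_eq_smul_one, sub_apply,
        Submodule.coe_sub, hpow n x, hQ]
      simp
    rw [ContinuousLinearMap.isUnit_iff_bijective]
    constructor
    · rw [injective_iff_map_eq_zero]
      rintro ⟨_, y, rfl⟩ h0
      have h1 := hval ⟨S y, y, rfl⟩
      have h1' := h1.symm.trans (congrArg Subtype.val h0)
      have h2 : (A - z ^ n • 1) (S y) = 0 := neg_eq_zero.1 h1'
      have h3 : y ∈ ((A - z ^ n • 1) * S).ker := h2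
      rw [hmax _ hA'] at h3
      exact Subtype.ext h3
    · rintro ⟨x, hx⟩
      rw [← hran hA'] at hx
      obtain ⟨y, hy⟩ := hx
      have hc : Commute (A - z ^ n • 1) S := by
        refine commute_of_mem_shiftProducts ?_ hS
        exact (Commute.refl A).sub_left ((Commute.one_left A).smul_left _)
      -- The sign is there because the operator to invert is `z^n - Q^n = -(A - z^n)`.
      refine ⟨⟨S (-y), -y, rfl⟩, Subtype.ext ?_⟩
      rw [hval]
      change -((A - z ^ n • 1) * S) (-y) = x
      rw [hc.eq, map_neg, neg_neg]
      exact hy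

end Splitting

/-! ### Operators which are limits of operators of finite rank -/

section Approximable

variable {X Y Z : Type*} [NormedAddCommGroup X] [NormedSpace ℂ X] [NormedAddCommGroup Y]
  [NormedSpace ℂ Y] [NormedAddCommGroup Z] [NormedSpace ℂ Z]

/-- `T` is the limit, for the operator norm, of operators of finite rank. -/
def IsApproximable (T : X →L[ℂ] Y) : Prop :=
  ∀ ε : ℝ, 0 < ε → ∃ K : X →L[ℂ] Y, FiniteDimensional ℂ K.range ∧ ‖T - K‖ ≤ ε

theorem IsApproximable.of_limit {T : X →L[ℂ] Y}
    (h : ∀ ε : ℝ, 0 < ε → ∃ K : X →L[ℂ] Y, IsApproximable K ∧ ‖T - K‖ ≤ ε) :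
    IsApproximable T := by
  intro ε hε
  obtain ⟨K, hK, hTK⟩ := h (ε / 2) (by positivity)
  obtain ⟨L, hL, hKL⟩ := hK (ε / 2) (by positivity)
  refine ⟨L, hL, ?_⟩
  have := norm_sub_le_norm_sub_add_norm_sub T K L
  linarith

theorem isApproximable_zero : IsApproximable (0 : X →L[ℂ] Y) := by
  intro ε hε
  refine ⟨0, ?_, by simpa using hε.le⟩
  have : (0 : X →L[ℂ] Y).range = ⊥ := by ext; simp
  rw [this]; infer_instance

theorem IsApproximable.add {S T : X →L[ℂ] Y} (hS : IsApproximable S) (hT : IsApproximable T) :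
    IsApproximable (S + T) := by
  intro ε hε
  obtain ⟨K, hK, hSK⟩ := hS (ε / 2) (by positivity)
  obtain ⟨L, hL, hTL⟩ := hT (ε / 2) (by positivity)
  refine ⟨K + L, ?_, ?_⟩
  · refine Submodule.finiteDimensional_of_le (S₂ := K.range ⊔ L.range) ?_
    rintro _ ⟨x, rfl⟩
    exact Submodule.add_mem_sup ⟨x, rfl⟩ ⟨x, rfl⟩
  · have h : S + T - (K + L) = (S - K) + (T - L) := by abel
    rw [h]
    have := norm_add_le (S - K) (T - L)
    linarith

theorem IsApproximable.sum {ι : Type*} (s : Finset ι) {T : ι → X →L[ℂ] Y}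
    (h : ∀ i ∈ s, IsApproximable (T i)) : IsApproximable (∑ i ∈ s, T i) :=
  Finset.sum_induction _ _ (fun _ _ => IsApproximable.add) isApproximable_zero h

theorem IsApproximable.comp_left {T : X →L[ℂ] Y} (hT : IsApproximable T) (A : Y →L[ℂ] Z) :
    IsApproximable (A ∘L T) := by
  intro ε hε
  obtain ⟨K, hK, hTK⟩ := hT (ε / (‖A‖ + 1)) (by positivity)
  refine ⟨A ∘L K, finiteDimensional_range_comp_left A hK, ?_⟩
  have h : A ∘L T - A ∘L K = A ∘L (T - K) := by ext; simp
  rw [h]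
  calc ‖A ∘L (T - K)‖ ≤ ‖A‖ * ‖T - K‖ := A.opNorm_comp_le _
    _ ≤ (‖A‖ + 1) * (ε / (‖A‖ + 1)) := by gcongr; linarith
    _ = ε := mul_div_cancel₀ _ (by positivity)

theorem IsApproximable.comp_right {T : Y →L[ℂ] Z} (hT : IsApproximable T) (A : X →L[ℂ] Y) :
    IsApproximable (T ∘L A) := by
  intro ε hε
  obtain ⟨K, hK, hTK⟩ := hT (ε / (‖A‖ + 1)) (by positivity)
  refine ⟨K ∘L A, finiteDimensional_range_comp_right hK A, ?_⟩
  have h : T ∘L A - K ∘L A = (T - K) ∘L A := by ext; simp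
  rw [h]
  calc ‖(T - K) ∘L A‖ ≤ ‖T - K‖ * ‖A‖ := (T - K).opNorm_comp_le _
    _ ≤ (ε / (‖A‖ + 1)) * (‖A‖ + 1) := by gcongr; linarith
    _ = ε := div_mul_cancel₀ _ (by positivity)

end Approximable

/-! ### Perturbation of a power-bounded rate by an operator with approximable sandwiches -/

section Perturbation

variable {B : Type*} [NormedAddCommGroup B] [NormedSpace ℂ B]

/-- A word in `T` and `R` with at least two letters `T` contains a block `T R^i T`, hence is
approximable. Only the words with no `T` or exactly one are left over. -/
theorem isApproximable_add_pow {T R : B →L[ℂ] B}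
    (hT : ∀ A : B →L[ℂ] B, IsApproximable (T * A * T)) (n : ℕ) :
    ∃ K, IsApproximable K ∧
      (T + R) ^ n = K + (R ^ n + ∑ i ∈ Finset.range n, R ^ i * T * R ^ (n - 1 - i)) := by
  induction n with
  | zero => exact ⟨0, isApproximable_zero, by simp⟩
  | succ n ih =>
    obtain ⟨K, hK, hpow⟩ := ih
    refine ⟨(T + R) * K + ∑ i ∈ Finset.range n, T * R ^ i * T * R ^ (n - 1 - i),
      (hK.comp_left (T + R)).add (IsApproximable.sum _ fun i _ =>
        (hT (R ^ i)).comp_right (R ^ (n - 1 - i))), ?_⟩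
    have h1 : ∑ i ∈ Finset.range (n + 1), R ^ i * T * R ^ (n + 1 - 1 - i)
        = R * (∑ i ∈ Finset.range n, R ^ i * T * R ^ (n - 1 - i)) + T * R ^ n := by
      rw [Finset.sum_range_succ', Finset.mul_sum]
      congr 1
      · refine Finset.sum_congr rfl fun i _ => ?_
        rw [pow_succ' R i, show n + 1 - 1 - (i + 1) = n - 1 - i by omega]
        simp only [mul_assoc]
    have h2 : ∑ i ∈ Finset.range n, T * R ^ i * T * R ^ (n - 1 - i)
        = T * ∑ i ∈ Finset.range n, R ^ i * T * R ^ (n - 1 - i) := by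
      rw [Finset.mul_sum]
      exact Finset.sum_congr rfl fun i _ => by simp only [mul_assoc]
    rw [pow_succ', hpow, h1, h2, pow_succ' R n]
    noncomm_ring

/-- The left-over words have total norm at most `M κ^n + (M² ‖T‖ / κ) n κ^n`, which is `o(ρ^n)`
since `κ < ρ`. -/
theorem exists_isSpectralSplitting_add [CompleteSpace B] {T R : B →L[ℂ] B}
    (hT : ∀ A : B →L[ℂ] B, IsApproximable (T * A * T)) {M κ : ℝ} (hκ : 0 < κ)
    (hR : ∀ n, ‖R ^ n‖ ≤ M * κ ^ n) {ρ : ℝ≥0} (hρ : κ < ρ) :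
    ∃ F H, IsSpectralSplitting (T + R) ρ F H := by
  have hρ0 : (0 : ℝ) < ρ := hκ.trans hρ
  have hM : 0 ≤ M := by simpa using (norm_nonneg _).trans (hR 0)
  set q : ℝ := κ / ρ with hq
  have hq0 : 0 ≤ q := by positivity
  have hq1 : q < 1 := (div_lt_one hρ0).2 hρ
  have hlim : Tendsto (fun n : ℕ => 4 * (M * q ^ n + (M * ‖T‖ * M / κ) * (n * q ^ n))) atTop
      (𝓝 (4 * (M * 0 + (M * ‖T‖ * M / κ) * 0))) :=
    (((tendsto_pow_atTop_nhds_zero_of_lt_one hq0 hq1).const_mul _).add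
      ((tendsto_self_mul_const_pow_of_lt_one hq0 hq1).const_mul _)).const_mul _
  -- The budget: four times the error is at most `(1/2 + 4/16) ρ^n < ρ^n`, the `1/16` coming from
  -- the finite rank approximation of `K`.
  have hev := hlim.eventually_lt_const (u := (1 / 2 : ℝ)) (by norm_num)
  obtain ⟨n, hn, hn1⟩ := (hev.and (eventually_ge_atTop 1)).exists
  obtain ⟨K, hK, hpow⟩ := isApproximable_add_pow (R := R) hT n
  obtain ⟨L, hL, hKL⟩ := hK ((ρ : ℝ) ^ n / 16) (by positivity)
  set S := ∑ i ∈ Finset.range n, R ^ i * T * R ^ (n - 1 - i) with hS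
  have hSn : ‖S‖ ≤ (M * ‖T‖ * M / κ) * (n * κ ^ n) := by
    have hterm : ∀ i ∈ Finset.range n,
        ‖R ^ i * T * R ^ (n - 1 - i)‖ ≤ (M * ‖T‖ * M / κ) * κ ^ n := by
      intro i hi
      have hi' := Finset.mem_range.1 hi
      calc ‖R ^ i * T * R ^ (n - 1 - i)‖ ≤ ‖R ^ i‖ * ‖T‖ * ‖R ^ (n - 1 - i)‖ :=
            (norm_mul_le _ _).trans (mul_le_mul_of_nonneg_right (norm_mul_le _ _) (norm_nonneg _))
        _ ≤ (M * κ ^ i) * ‖T‖ * (M * κ ^ (n - 1 - i)) := by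
            gcongr
            · exact hR i
            · exact hR _
        _ = (M * ‖T‖ * M / κ) * (κ ^ i * κ ^ (n - 1 - i) * κ) := by field_simp
        _ = (M * ‖T‖ * M / κ) * κ ^ n := by
            rw [← pow_add, ← pow_succ, show i + (n - 1 - i) + 1 = n by omega]
    refine (norm_sum_le_of_le _ hterm).trans (le_of_eq ?_)
    rw [Finset.sum_const, Finset.card_range, nsmul_eq_mul]
    ring
  refine exists_isSpectralSplitting (K := L) (R := K - L + (R ^ n + S)) (n := n) (by omega)
    (by rw [hpow]; abel) hL ?_
  have hκq : κ ^ n = q ^ n * (ρ : ℝ) ^ n := by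
    rw [← mul_pow, hq, div_mul_cancel₀ _ hρ0.ne']
  have h1 : ‖K - L + (R ^ n + S)‖ ≤ (ρ : ℝ) ^ n / 16 + (M * κ ^ n +
      (M * ‖T‖ * M / κ) * (n * κ ^ n)) :=
    (norm_add_le _ _).trans (add_le_add hKL ((norm_add_le _ _).trans (add_le_add (hR n) hSn)))
  have h2 : 4 * (M * κ ^ n + (M * ‖T‖ * M / κ) * (n * κ ^ n))
      = (4 * (M * q ^ n + (M * ‖T‖ * M / κ) * (n * q ^ n))) * (ρ : ℝ) ^ n := by
    rw [hκq]; ring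
  have hρn : (0 : ℝ) < (ρ : ℝ) ^ n := by positivity
  nlinarith

theorem essSpectralRadius_le_of_forall_splitting {Q : B →L[ℂ] B} {c : ℝ≥0∞}
    (h : ∀ ρ : ℝ≥0, c < ρ → ∃ F H, IsSpectralSplitting Q ρ F H) : essSpectralRadius Q ≤ c := by
  refine le_of_forall_gt fun a ha => ?_
  obtain ⟨ρ, hρ, hρa⟩ := ENNReal.lt_iff_exists_nnreal_btwn.1 ha
  exact lt_of_le_of_lt (sInf_le (Set.mem_insert_of_mem _ ⟨ρ, h ρ hρ, rfl⟩)) hρa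

end Perturbation

/-! ### Approximation by operators of finite rank in Hilbert spaces -/

section Hilbert

variable {H G : Type*} [NormedAddCommGroup H] [InnerProductSpace ℂ H]
  [NormedAddCommGroup G] [NormedSpace ℂ G]

/-- If the sums `∑ ‖S e‖²` over orthonormal families are bounded, as they are for a Hilbert-Schmidt
operator, then `S` is a limit of operators of finite rank. -/
theorem isApproximable_of_orthonormal_sum_le [CompleteSpace H] {S : H →L[ℂ] G} {M : ℝ}
    (hS : ∀ (n : ℕ) (e : Fin n → H), Orthonormal ℂ e → ∑ i, ‖S (e i)‖ ^ 2 ≤ M) :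
    IsApproximable S := by
  intro ε hε
  -- Otherwise arbitrarily long orthonormal families with `‖S (e i)‖ ≥ ε` can be built one vector at
  -- a time, and `n ε² ≤ M` fails for large `n`. The approximant is then `S` composed with the
  -- projection onto the span of `e`.
  have hmain : ∃ (n : ℕ) (e : Fin n → H), Orthonormal ℂ e ∧
      ∀ v, (∀ i, inner ℂ (e i) v = 0) → ‖v‖ = 1 → ‖S v‖ ≤ ε := by
    by_contra! hcon
    have hseq : ∀ n : ℕ, ∃ e : Fin n → H, Orthonormal ℂ e ∧ ∀ i, ε ≤ ‖S (e i)‖ := by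
      intro n
      induction n with
      | zero => exact ⟨Fin.elim0, ⟨fun i => i.elim0, fun i => i.elim0⟩, fun i => i.elim0⟩
      | succ n ih =>
        obtain ⟨e, he, heε⟩ := ih
        obtain ⟨v, hv, hv1, hvε⟩ := hcon n e he
        refine ⟨Fin.cons v e, ?_, ?_⟩
        · refine ⟨fun i => ?_, fun i j hij => ?_⟩
          · refine Fin.cases ?_ (fun i => ?_) i
            · simpa using hv1
            · simpa using he.1 i
          · revert hij
            refine Fin.cases ?_ (fun i => ?_) i <;> refine Fin.cases ?_ (fun j => ?_) j
            · intro h; exact absurd rfl h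
            · intro _
              simp only [Fin.cons_zero, Fin.cons_succ]
              rw [← inner_conj_symm, hv j, map_zero]
            · intro _
              simpa using hv i
            · intro hij
              simp only [Fin.cons_succ]
              exact he.2 fun h => hij (by rw [h])
        · intro i
          refine Fin.cases ?_ (fun i => ?_) i
          · simpa using hvε.le
          · simpa using heε i
    obtain ⟨n, hn⟩ := exists_nat_gt (M / ε ^ 2)
    obtain ⟨e, he, heε⟩ := hseq n
    have h1 := hS n e he
    have h2 : ∑ _i : Fin n, ε ^ 2 ≤ ∑ i, ‖S (e i)‖ ^ 2 :=
      Finset.sum_le_sum fun i _ => pow_le_pow_left₀ hε.le (heε i) 2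
    rw [Finset.sum_const, Finset.card_univ, Fintype.card_fin, nsmul_eq_mul] at h2
    rw [div_lt_iff₀ (by positivity)] at hn
    linarith
  obtain ⟨n, e, he, hev⟩ := hmain
  set V := Submodule.span ℂ (Set.range e) with hV
  have hVfin : FiniteDimensional ℂ V := FiniteDimensional.span_of_finite ℂ (Set.finite_range e)
  refine ⟨S ∘L V.starProjection, ?_, ?_⟩
  · refine finiteDimensional_range_comp_left S ?_
    rw [Submodule.range_starProjection]
    exact hVfin
  · refine ContinuousLinearMap.opNorm_le_bound _ hε.le fun x => ?_
    set v := x - V.starProjection x with hv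
    have hvV : v ∈ Vᗮ := V.sub_starProjection_mem_orthogonal x
    have hvx : ‖v‖ ≤ ‖x‖ := by
      have : v = Vᗮ.starProjection x := by
        rw [hv, Submodule.starProjection_orthogonal_val]
      rw [this]; exact Vᗮ.norm_starProjection_apply_le x
    have hval : (S - S ∘L V.starProjection) x = S v := by simp [hv]
    rw [hval]
    rcases eq_or_ne v 0 with h0 | h0
    · rw [h0, map_zero, norm_zero]; positivity
    · have hn0 : (‖v‖ : ℂ) ≠ 0 := by exact_mod_cast (norm_ne_zero_iff.2 h0)
      have h1 := hev ((‖v‖ : ℂ)⁻¹ • v) (fun i => by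
        rw [inner_smul_right, (Submodule.mem_orthogonal V v).1 hvV (e i)
          (Submodule.subset_span ⟨i, rfl⟩), mul_zero]) (by
        rw [norm_smul, norm_inv, Complex.norm_real, norm_norm,
          inv_mul_cancel₀ (norm_ne_zero_iff.2 h0)])
      rw [map_smul, norm_smul, norm_inv, Complex.norm_real, norm_norm,
        inv_mul_le_iff₀ (norm_pos_iff.2 h0)] at h1
      calc ‖S v‖ ≤ ‖v‖ * ε := h1
        _ ≤ ε * ‖x‖ := by rw [mul_comm]; gcongr

end Hilbert

/-! ### The weighted space is a Banach space -/

section WeightedSpaceBasics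

variable {E : Type*} [MeasurableSpace E] {w : WeightFunction E}

namespace WeightedSpace

theorem measurable_coe (f : WeightedSpace w) : Measurable (f : E → ℂ) := f.2.1

theorem ext_apply {f g : WeightedSpace w} (h : ∀ x, f x = g x) : f = g :=
  Subtype.ext (funext h)

protected theorem add_apply (f g : WeightedSpace w) (x : E) : (f + g) x = f x + g x := rfl

protected theorem sub_apply (f g : WeightedSpace w) (x : E) : (f - g) x = f x - g x := rfl

protected theorem smul_apply (c : ℂ) (f : WeightedSpace w) (x : E) : (c • f) x = c * f x := rfl

theorem norm_apply_le (f : WeightedSpace w) (x : E) : ‖f x‖ ≤ ‖f‖ * w x :=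
  (div_le_iff₀ (weight_pos w x)).1 (div_le_norm f x)

theorem enorm_apply_le (f : WeightedSpace w) (x : E) : ‖f x‖ₑ ≤ ‖f‖ₑ * w x := by
  have h := norm_apply_le f x
  rw [← ofReal_norm, ← ofReal_norm, ← ENNReal.ofReal_coe_nnreal,
    ← ENNReal.ofReal_mul (norm_nonneg _)]
  exact ENNReal.ofReal_le_ofReal h

theorem norm_le_of_apply_le {f : WeightedSpace w} {M : ℝ} (hM : 0 ≤ M)
    (h : ∀ x, ‖f x‖ ≤ M * w x) : ‖f‖ ≤ M := by
  rw [norm_def]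
  exact Real.iSup_le (fun x => (div_le_iff₀ (weight_pos w x)).2 (h x)) hM

theorem exists_eq {f : E → ℂ} (hf : Measurable f) {M : ℝ} (h : ∀ x, ‖f x‖ ≤ M * w x) :
    ∃ g : WeightedSpace w, ∀ x, g x = f x :=
  ⟨⟨f, hf, M, fun x => (div_le_iff₀ (weight_pos w x)).2 (h x)⟩, fun _ => rfl⟩

variable {X : Type*} [NormedAddCommGroup X] [NormedSpace ℂ X]

theorem opNorm_le_of_apply_le {T : X →L[ℂ] WeightedSpace w} {M : ℝ} (hM : 0 ≤ M)
    (h : ∀ v x, ‖T v x‖ ≤ M * ‖v‖ * w x) : ‖T‖ ≤ M :=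
  T.opNorm_le_bound hM fun v => norm_le_of_apply_le (by positivity) (h v)

theorem exists_continuousLinearMap_eq {φ : X → E → ℂ} (hmeas : ∀ v, Measurable (φ v))
    (hadd : ∀ u v x, φ (u + v) x = φ u x + φ v x) (hsmul : ∀ (c : ℂ) v x, φ (c • v) x = c * φ v x)
    {M : ℝ} (hM : 0 ≤ M) (h : ∀ v x, ‖φ v x‖ ≤ M * ‖v‖ * w x) :
    ∃ T : X →L[ℂ] WeightedSpace w, ∀ v x, T v x = φ v x := by
  choose g hg using fun v => exists_eq (w := w) (hmeas v) (h v)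
  let L : X →ₗ[ℂ] WeightedSpace w :=
    { toFun := g
      map_add' := fun u v => ext_apply fun x => by rw [WeightedSpace.add_apply, hg, hg, hg, hadd]
      map_smul' := fun c v => ext_apply fun x => by
        rw [RingHom.id_apply, WeightedSpace.smul_apply, hg, hg, hsmul] }
  refine ⟨L.mkContinuous M fun v => ?_, hg⟩
  exact norm_le_of_apply_le (by positivity) fun x => by
    have : (L v) x = φ v x := hg v x
    rw [this]; exact h v x

instance : CompleteSpace (WeightedSpace w) := by
  refine Metric.complete_of_cauchySeq_tendsto fun u hu => ?_
  have hptC : ∀ x, CauchySeq fun n => u n x := by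
    intro x
    rw [Metric.cauchySeq_iff'] at hu ⊢
    intro ε hε
    obtain ⟨N, hN⟩ := hu (ε / w x) (div_pos hε (weight_pos w x))
    refine ⟨N, fun n hn => ?_⟩
    rw [dist_eq_norm, ← WeightedSpace.sub_apply]
    refine lt_of_le_of_lt (norm_apply_le _ x) ?_
    rw [← dist_eq_norm]
    exact (lt_div_iff₀ (weight_pos w x)).1 (hN n hn)
  choose f hf using fun x => cauchySeq_tendsto_of_complete (hptC x)
  have hmeas : Measurable f :=
    measurable_of_tendsto_metrizable (fun n => (u n).measurable_coe) (tendsto_pi_nhds.2 hf)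
  have hlim : ∀ ε : ℝ, 0 < ε → ∃ N, ∀ n ≥ N, ∀ x, ‖u n x - f x‖ ≤ ε * w x := by
    intro ε hε
    obtain ⟨N, hN⟩ := Metric.cauchySeq_iff.1 hu ε hε
    refine ⟨N, fun n hn x => ?_⟩
    refine le_of_tendsto ((tendsto_const_nhds.sub (hf x)).norm) ?_
    filter_upwards [eventually_ge_atTop N] with m hm
    rw [← WeightedSpace.sub_apply]
    refine (norm_apply_le _ x).trans ?_
    rw [← dist_eq_norm]
    exact mul_le_mul_of_nonneg_right (hN n hn m hm).le (weight_pos w x).le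
  obtain ⟨N, hN⟩ := hlim 1 one_pos
  obtain ⟨g, hg⟩ := exists_eq (w := w) (M := ‖u N‖ + 1) hmeas fun x => by
    have h1 := hN N le_rfl x
    have h2 := norm_apply_le (u N) x
    have h3 := norm_sub_norm_le (f x) (u N x)
    rw [norm_sub_rev] at h3
    linarith
  refine ⟨g, Metric.tendsto_atTop.2 fun ε hε => ?_⟩
  obtain ⟨N, hN⟩ := hlim (ε / 2) (by positivity)
  refine ⟨N, fun n hn => ?_⟩
  rw [dist_eq_norm]
  refine lt_of_le_of_lt (norm_le_of_apply_le (by positivity) fun x => ?_) (half_lt_self hε)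
  rw [WeightedSpace.sub_apply, hg]
  exact hN n hn x

end WeightedSpace

end WeightedSpaceBasics

/-! ### Operators defined by kernels -/

section KernelOperators

variable {E : Type*} [MeasurableSpace E] {w : WeightFunction E}

open WeightedSpace

theorem lintegral_enorm_mul_le {μ : Measure E} {f : E → ℂ} {χ : E × E → ℂ} {c : ℝ≥0}
    (hc : ∀ p, ‖χ p‖ ≤ c) {φ : E → ℝ≥0∞} (hf : ∀ y, ‖f y‖ₑ ≤ φ y) (x : E) :
    ∫⁻ y, ‖f y * χ (x, y)‖ₑ ∂μ ≤ c * ∫⁻ y, φ y ∂μ := by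
  rw [← lintegral_const_mul' _ _ ENNReal.coe_ne_top]
  refine lintegral_mono fun y => ?_
  rw [enorm_mul, mul_comm]
  refine mul_le_mul' ?_ (hf y)
  have : ‖χ (x, y)‖₊ ≤ c := hc (x, y)
  exact ENNReal.coe_le_coe.2 this

/-- The majorant `φ` need not be measurable, so the bound can be iterated with functions such as
hitting-time generating functions without proving their measurability. -/
theorem IsKernelOperator.enorm_apply_le {Q : Kernel E E} {χ : E × E → ℂ}
    {T : WeightedSpace w →L[ℂ] WeightedSpace w} (hT : IsKernelOperator Q χ T) {c : ℝ≥0}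
    (hc : ∀ p, ‖χ p‖ ≤ c) {f : WeightedSpace w} {φ : E → ℝ≥0∞} (hf : ∀ y, ‖f y‖ₑ ≤ φ y) (x : E) :
    ‖T f x‖ₑ ≤ c * ∫⁻ y, φ y ∂(Q x) := by
  rw [(hT f x).2]
  exact (enorm_integral_le_lintegral_enorm _).trans (lintegral_enorm_mul_le hc hf x)

theorem exists_isKernelOperator (Q : Kernel E E) [IsSFiniteKernel Q] {m c : ℝ≥0}
    (hm : ∀ x, ∫⁻ y, (w y : ℝ≥0∞) ∂(Q x) ≤ m * w x) {χ : E × E → ℂ} (hχ : Measurable χ)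
    (hc : ∀ p, ‖χ p‖ ≤ c) :
    ∃ T : WeightedSpace w →L[ℂ] WeightedSpace w, IsKernelOperator Q χ T := by
  have hmeas : ∀ f : WeightedSpace w, Measurable fun p : E × E => f p.2 * χ p := fun f =>
    (f.measurable_coe.comp measurable_snd).mul hχ
  have hle : ∀ (f : WeightedSpace w) x,
      ∫⁻ y, ‖f y * χ (x, y)‖ₑ ∂(Q x) ≤ c * (‖f‖ₑ * (m * w x)) := by
    intro f x
    refine (lintegral_enorm_mul_le hc (f.enorm_apply_le) x).trans ?_
    rw [lintegral_const_mul' _ _ enorm_ne_top]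
    gcongr
    exact hm x
  have hint : ∀ (f : WeightedSpace w) x, Integrable (fun y => f y * χ (x, y)) (Q x) := by
    intro f x
    refine ⟨((hmeas f).comp measurable_prodMk_left).aestronglyMeasurable, ?_⟩
    exact lt_of_le_of_lt (hle f x) (ENNReal.mul_lt_top ENNReal.coe_lt_top
      (ENNReal.mul_lt_top enorm_lt_top (ENNReal.mul_lt_top ENNReal.coe_lt_top ENNReal.coe_lt_top)))
  obtain ⟨T, hT⟩ := exists_continuousLinearMap_eq (w := w) (X := WeightedSpace w)
    (φ := fun f x => ∫ y, f y * χ (x, y) ∂(Q x)) (M := c * m)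
    (fun f => ((hmeas f).stronglyMeasurable.integral_kernel_prod_right' (κ := Q)).measurable)
    (fun f g x => by
      rw [← integral_add (hint f x) (hint g x)]
      exact integral_congr_ae (.of_forall fun y => by simp only [WeightedSpace.add_apply, add_mul]))
    (fun a f x => by
      rw [← integral_const_mul]
      exact integral_congr_ae (.of_forall fun y => by simp only [WeightedSpace.smul_apply, mul_assoc]))
    (by positivity)
    (fun f x => by
      have h := (enorm_integral_le_lintegral_enorm _).trans (hle f x)
      have h' : ‖∫ y, f y * χ (x, y) ∂(Q x)‖₊ ≤ c * (‖f‖₊ * (m * w x)) := by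
        rw [enorm_eq_nnnorm, enorm_eq_nnnorm] at h
        exact_mod_cast h
      have h'' : ‖∫ y, f y * χ (x, y) ∂(Q x)‖ ≤ c * (‖f‖ * (m * w x)) := by
        exact_mod_cast h'
      linarith)
  exact ⟨T, fun f x => ⟨hint f x, hT f x⟩⟩

end KernelOperators

/-! ### Absolutely continuous kernels and operators of finite rank -/

section AbsolutelyContinuous

variable {E : Type*} [MeasurableSpace E] {w : WeightFunction E}

open WeightedSpace

theorem measurable_weight_complex (w : WeightFunction E) :
    Measurable fun y => ((w y : ℝ) : ℂ) :=
  Complex.measurable_ofReal.comp (measurable_subtype_coe.comp w.measurable')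

theorem norm_weight_complex (w : WeightFunction E) (y : E) : ‖((w y : ℝ) : ℂ)‖ = w y := by
  rw [Complex.norm_real, Real.norm_of_nonneg (w y).coe_nonneg]

theorem exists_lintegral_tail_le (ν : Measure E) {α : E × E → ℝ≥0}
    (hα : α ∈ weightedDensities w ν) {ε : ℝ≥0∞} (hε : 0 < ε) : ∃ m : ℝ≥0, ∀ x,
      ∫⁻ y in {y | m ≤ (w x)⁻¹ * α (x, y) * w y}, ((w x)⁻¹ * α (x, y) * w y : ℝ≥0) ∂ν ≤ ε := by
  obtain ⟨m, hm⟩ := (hα.2.2.eventually_le_const hε).exists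
  exact ⟨m, fun x => (le_iSup _ x).trans hm⟩

variable (ν : Measure E) [IsProbabilityMeasure ν]

theorem WeightedSpace.memLp_div (f : WeightedSpace w) :
    MemLp (fun y => f y / ((w y : ℝ) : ℂ)) 2 ν := by
  refine MemLp.of_bound (f.measurable_coe.div
    (measurable_weight_complex w)).aestronglyMeasurable ‖f‖ (.of_forall fun y => ?_)
  rw [norm_div, norm_weight_complex]
  exact div_le_norm f y

/-- The map `f ↦ w⁻¹ f` from `𝓑_w` to `L²(ν)`. -/
noncomputable def toL2 : WeightedSpace w →L[ℂ] Lp ℂ 2 ν :=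
  LinearMap.mkContinuous
    { toFun := fun f => (f.memLp_div ν).toLp
      map_add' := fun f g => by
        rw [← MemLp.toLp_add, MemLp.toLp_eq_toLp_iff]
        exact .of_forall fun y => add_div _ _ _
      map_smul' := fun c f => by
        rw [RingHom.id_apply, ← MemLp.toLp_const_smul, MemLp.toLp_eq_toLp_iff]
        exact .of_forall fun y => mul_div_assoc _ _ _ } 1 fun f => by
    have h : ‖(f.memLp_div ν).toLp‖ ≤ _ := Lp.norm_le_of_ae_bound (norm_nonneg f) (by
      filter_upwards [(f.memLp_div ν).coeFn_toLp] with y hy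
      rw [hy, norm_div, norm_weight_complex]
      exact div_le_norm f y)
    have h1 : measureUnivNNReal ν = 1 := by simp [measureUnivNNReal]
    simpa [h1] using h

theorem toL2_ae_eq (f : WeightedSpace w) :
    (toL2 ν f : E → ℂ) =ᵐ[ν] fun y => f y / ((w y : ℝ) : ℂ) :=
  (f.memLp_div ν).coeFn_toLp

theorem norm_toL2_sq (f : WeightedSpace w) :
    ‖toL2 ν f‖ ^ 2 = ∫ y, (‖f y‖ / w y) ^ 2 ∂ν := by
  have h1 := inner_self_eq_norm_sq (𝕜 := ℂ) (toL2 ν f)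
  rw [← h1, L2.inner_def, ← integral_re (L2.integrable_inner _ _)]
  refine integral_congr_ae ?_
  filter_upwards [toL2_ae_eq ν f] with y hy
  rw [inner_self_eq_norm_sq (𝕜 := ℂ), hy, norm_div, norm_weight_complex]

/-- Bessel's inequality for the functional `v ↦ A v x / w x`, whose norm is at most `‖A‖`. -/
theorem sum_norm_apply_sq_le {H : Type*} [NormedAddCommGroup H] [InnerProductSpace ℂ H]
    (A : H →L[ℂ] WeightedSpace w) {n : ℕ} {e : Fin n → H} (he : Orthonormal ℂ e) (x : E) :
    ∑ i, (‖A (e i) x‖ / w x) ^ 2 ≤ ‖A‖ ^ 2 := by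
  -- Conjugate coefficients make `v = ∑ c i • e i` the extremal vector: `‖v‖² = s` and `A v x = s
  -- w(x)`, whence `s ≤ ‖A‖ √s`.
  set c : Fin n → ℂ := fun i => (starRingEnd ℂ) (A (e i) x / ((w x : ℝ) : ℂ)) with hc
  have hcn : ∀ i, ‖c i‖ = ‖A (e i) x‖ / w x := fun i => by
    rw [hc, RCLike.norm_conj, norm_div, norm_weight_complex]
  set s : ℝ := ∑ i, (‖A (e i) x‖ / w x) ^ 2 with hs
  have hs0 : 0 ≤ s := Finset.sum_nonneg fun i _ => sq_nonneg _
  set v := ∑ i, c i • e i with hv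
  have hvn : ‖v‖ ^ 2 = s := by
    rw [← inner_self_eq_norm_sq (𝕜 := ℂ), hv, he.inner_sum]
    rw [map_sum, hs]
    refine Finset.sum_congr rfl fun i _ => ?_
    rw [← hcn, RCLike.conj_mul]
    norm_cast
  have hsum : ∀ t : Finset (Fin n), (∑ i ∈ t, c i • A (e i) : WeightedSpace w) x
      = ∑ i ∈ t, c i * A (e i) x := by
    intro t
    induction t using Finset.cons_induction with
    | empty => rfl
    | cons a t ha ih =>
      rw [Finset.sum_cons, Finset.sum_cons, WeightedSpace.add_apply, ih]; rfl
  have hAv : A v x = s * w x := by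
    have hw : ((w x : ℝ) : ℂ) ≠ 0 := by exact_mod_cast (weight_pos w x).ne'
    rw [hv, map_sum]
    simp only [map_smul]
    rw [hsum, hs, Complex.ofReal_sum, Finset.sum_mul]
    refine Finset.sum_congr rfl fun i _ => ?_
    have h1 : A (e i) x = (starRingEnd ℂ) (c i) * ((w x : ℝ) : ℂ) := by
      simp only [hc, Complex.conj_conj]
      rw [div_mul_cancel₀ _ hw]
    rw [← hcn, Complex.ofReal_pow, ← Complex.mul_conj', mul_assoc, h1]
  have h1 := norm_apply_le (A v) x
  rw [hAv, norm_mul, norm_weight_complex, Complex.norm_real, Real.norm_of_nonneg hs0] at h1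
  have h2 : s ≤ ‖A‖ * ‖v‖ := (le_of_mul_le_mul_right h1 (weight_pos w x)).trans (A.le_opNorm v)
  rcases eq_or_ne ‖v‖ 0 with h0 | h0
  · rw [← hvn, h0]; simp
  · have hvp : 0 < ‖v‖ := lt_of_le_of_ne (norm_nonneg _) h0.symm
    have : ‖v‖ ≤ ‖A‖ := by
      rw [← hvn] at h2; nlinarith
    rw [← hvn]; gcongr

/-- A bounded operator from a Hilbert space to `𝓑_w`, viewed in `L²(ν)`, is Hilbert-Schmidt. -/
theorem isApproximable_toL2_comp {H : Type*} [NormedAddCommGroup H] [InnerProductSpace ℂ H]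
    [CompleteSpace H] (A : H →L[ℂ] WeightedSpace w) : IsApproximable (toL2 ν ∘L A) := by
  refine isApproximable_of_orthonormal_sum_le (M := ‖A‖ ^ 2) fun n e he => ?_
  have hmeas : ∀ f : WeightedSpace w, Measurable fun y => (‖f y‖ / w y) ^ 2 := fun f =>
    (f.measurable_coe.norm.div (measurable_subtype_coe.comp w.measurable')).pow_const 2
  have hint : ∀ f : WeightedSpace w, Integrable (fun y => (‖f y‖ / w y) ^ 2) ν := fun f =>
    Integrable.of_bound (hmeas f).aestronglyMeasurable (‖f‖ ^ 2) (.of_forall fun y => by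
      rw [Real.norm_of_nonneg (by positivity)]
      exact pow_le_pow_left₀ (by positivity) (div_le_norm f y) 2)
  calc ∑ i, ‖(toL2 ν ∘L A) (e i)‖ ^ 2 = ∑ i, ∫ y, (‖A (e i) y‖ / w y) ^ 2 ∂ν :=
        Finset.sum_congr rfl fun i _ => norm_toL2_sq ν (A (e i))
    _ = ∫ y, ∑ i, (‖A (e i) y‖ / w y) ^ 2 ∂ν :=
        (integral_finsetSum _ fun i _ => hint (A (e i))).symm
    _ ≤ ∫ _, ‖A‖ ^ 2 ∂ν := integral_mono (integrable_finsetSum _ fun i _ => hint (A (e i)))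
        (integrable_const _) (sum_norm_apply_sq_le A he)
    _ = ‖A‖ ^ 2 := by simp

theorem integral_norm_le_norm_L2 (g : Lp ℂ 2 ν) : ∫ y, ‖g y‖ ∂ν ≤ ‖g‖ := by
  rw [integral_norm_eq_lintegral_enorm (Lp.aestronglyMeasurable g), Lp.norm_def,
    ← eLpNorm_one_eq_lintegral_enorm]
  exact ENNReal.toReal_mono (Lp.eLpNorm_ne_top g)
    (eLpNorm_le_eLpNorm_of_exponent_le (by norm_num) (Lp.aestronglyMeasurable g))

/-- The operators from `L²(ν)` to `𝓑_w` given by kernels `k` such that `w(x)⁻¹ |k(x, y)|` is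
bounded. -/
theorem exists_operator_of_bounded_kernel {k : E × E → ℂ} (hk : Measurable k) {M : ℝ} (hM : 0 ≤ M)
    (hkM : ∀ x y, ‖k (x, y)‖ ≤ M * w x) :
    ∃ J : Lp ℂ 2 ν →L[ℂ] WeightedSpace w, 
      ∀ (g : Lp ℂ 2 ν) x, J g x = ∫ y, g y * k (x, y) ∂ν := by
  have hint : ∀ (g : Lp ℂ 2 ν) x, Integrable (fun y => g y * k (x, y)) ν := fun g x =>
    ((Lp.memLp g).integrable (by norm_num)).mul_bdd
      (hk.comp measurable_prodMk_left).aestronglyMeasurable (.of_forall (hkM x))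
  refine exists_continuousLinearMap_eq (X := Lp ℂ 2 ν) (φ := fun g x => ∫ y, g y * k (x, y) ∂ν) (M := M)
    (fun g => ?_) (fun f g x => ?_) (fun c g x => ?_) hM fun g x => ?_
  · refine (StronglyMeasurable.integral_prod_right' (f := fun p : E × E => g p.2 * k p)
      (((Lp.stronglyMeasurable g).comp_measurable measurable_snd).mul
        hk.stronglyMeasurable)).measurable
  · rw [← integral_add (hint f x) (hint g x)]
    refine integral_congr_ae ?_
    filter_upwards [Lp.coeFn_add f g] with y hy
    rw [hy, Pi.add_apply, add_mul]
  · rw [← integral_const_mul]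
    refine integral_congr_ae ?_
    filter_upwards [Lp.coeFn_smul c g] with y hy
    rw [hy, Pi.smul_apply, smul_eq_mul, mul_assoc]
  · calc ‖∫ y, g y * k (x, y) ∂ν‖ ≤ ∫ y, ‖g y * k (x, y)‖ ∂ν := norm_integral_le_integral_norm _
      _ ≤ ∫ y, ‖g y‖ * (M * w x) ∂ν := by
          refine integral_mono (hint g x).norm
            (((Lp.memLp g).integrable (by norm_num)).norm.mul_const _) fun y => ?_
          change ‖g y * k (x, y)‖ ≤ _
          rw [norm_mul]
          exact mul_le_mul_of_nonneg_left (hkM x y) (norm_nonneg _)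
      _ = (∫ y, ‖g y‖ ∂ν) * (M * w x) := integral_mul_const _ _
      _ ≤ ‖g‖ * (M * w x) := by
          gcongr
          exact integral_norm_le_norm_L2 ν g
      _ = M * ‖g‖ * w x := by ring

theorem densityKernel_apply {β : E × E → ℝ≥0} (hβ : Measurable β) (x : E) :
    densityKernel ν β x = ν.withDensity fun y => (β (x, y) : ℝ≥0∞) := by
  rw [densityKernel, Kernel.withDensity_apply _ (by
    exact measurable_coe_nnreal_ennreal.comp hβ), Kernel.const_apply]

/-- Truncating the density replaces `N` by `N' = J ∘ toL2`, and in `N' A N' = J (toL2 A J) toL2` the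
middle factor is Hilbert-Schmidt. The sandwich is what produces this factor. -/
theorem isApproximable_mul_mul {α β : E × E → ℝ≥0} (hα : α ∈ weightedDensities w ν)
    (hβ : Measurable β) (hβα : ∀ p, β p ≤ α p) {χ : E × E → ℂ} (hχ : Measurable χ) {c : ℝ≥0}
    (hc : ∀ p, ‖χ p‖ ≤ c) {N : WeightedSpace w →L[ℂ] WeightedSpace w}
    (hN : IsKernelOperator (densityKernel ν β) χ N)
    (A : WeightedSpace w →L[ℂ] WeightedSpace w) : IsApproximable (N * A * N) := by
  have happ : ∀ f x, Integrable (fun y => (β (x, y) : ℂ) * (f y * χ (x, y))) ν ∧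
      N f x = ∫ y, (β (x, y) : ℂ) * (f y * χ (x, y)) ∂ν := by
    intro f x
    have hβx : Measurable fun y => β (x, y) := hβ.comp measurable_prodMk_left
    have h := hN f x
    rw [densityKernel_apply ν hβ, integral_withDensity_eq_integral_smul hβx,
      integrable_withDensity_iff_integrable_smul hβx] at h
    exact h
  -- the truncated operators
  have htrunc : ∀ ε : ℝ, 0 < ε → ∃ J : Lp ℂ 2 ν →L[ℂ] WeightedSpace w,
      ‖N - J ∘L toL2 ν‖ ≤ ε := by
    intro ε hε
    obtain ⟨m, hm⟩ := exists_lintegral_tail_le ν hα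
      (ε := ENNReal.ofReal (ε / (c + 1))) (by rw [ENNReal.ofReal_pos]; positivity)
    let αw : E × E → ℝ≥0 := fun p => (w p.1)⁻¹ * α p * w p.2
    have hαw : Measurable αw := hα.2.1
    let D : Set (E × E) := {p | αw p < m}
    have hD : MeasurableSet D := measurableSet_lt hαw measurable_const
    -- The factor `w(y)` undoes the division by `w` in `toL2`. On `D` one has `α(x, y) w(y) ≤ m
    -- w(x)`, so `k` is bounded by `c m w(x)`.
    let k : E × E → ℂ := D.indicator fun p => ((w p.2 : ℝ) : ℂ) * ((β p : ℂ) * χ p)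
    have hk : Measurable k := (((measurable_weight_complex w).comp measurable_snd).mul
      ((Complex.measurable_ofReal.comp (measurable_subtype_coe.comp hβ)).mul hχ)).indicator hD
    have hkM : ∀ x y, ‖k (x, y)‖ ≤ (c * m) * w x := by
      intro x y
      by_cases hxy : (x, y) ∈ D
      · have h1 : αw (x, y) ≤ m := le_of_lt hxy
        have h2 : (α (x, y) : ℝ) * w y ≤ m * w x := by
          have h3 : ((w x : ℝ))⁻¹ * α (x, y) * w y ≤ m := by exact_mod_cast h1
          have hwx := weight_pos w x
          rw [mul_assoc, inv_mul_le_iff₀ hwx] at h3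
          linarith
        have h4 : (β (x, y) : ℝ) ≤ α (x, y) := hβα (x, y)
        simp only [k, Set.indicator_of_mem hxy, norm_mul]
        rw [norm_weight_complex]
        have h5 : ‖(β (x, y) : ℂ)‖ = β (x, y) := by
          rw [Complex.norm_real, Real.norm_of_nonneg (β (x, y)).coe_nonneg]
        rw [h5]
        calc (w y : ℝ) * (β (x, y) * ‖χ (x, y)‖) ≤ w y * (α (x, y) * c) := by
              gcongr
              exact hc _
          _ = c * (α (x, y) * w y) := by ring
          _ ≤ c * (m * w x) := by gcongr
          _ = c * m * w x := by ring
      · simp only [k, Set.indicator_of_notMem hxy, norm_zero]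
        positivity
    obtain ⟨J, hJ⟩ := exists_operator_of_bounded_kernel ν hk (by positivity) hkM
    let N' : WeightedSpace w →L[ℂ] WeightedSpace w := J ∘L toL2 ν
    let Δ : WeightedSpace w →L[ℂ] WeightedSpace w := N - N'
    refine ⟨J, opNorm_le_of_apply_le (T := Δ) hε.le fun f x => ?_⟩
    have hJf : N' f x
        = ∫ y, D.indicator (fun p => (β p : ℂ) * (f p.2 * χ p)) (x, y) ∂ν := by
      rw [show N' f = J (toL2 ν f) from rfl, hJ]
      refine integral_congr_ae ?_
      filter_upwards [toL2_ae_eq ν f] with y hy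
      rw [hy]
      have hw : ((w y : ℝ) : ℂ) ≠ 0 := by exact_mod_cast (weight_pos w y).ne'
      by_cases hxy : (x, y) ∈ D
      · simp only [k, Set.indicator_of_mem hxy]
        field_simp
      · simp only [k, Set.indicator_of_notMem hxy, mul_zero]
    have hDx : MeasurableSet {y | (x, y) ∈ D} := measurable_prodMk_left hD
    have hintD : Integrable
        (fun y => D.indicator (fun p => (β p : ℂ) * (f p.2 * χ p)) (x, y)) ν :=
      (happ f x).1.indicator hDx
    have hdiff : Δ f x
        = ∫ y, Dᶜ.indicator (fun p => (β p : ℂ) * (f p.2 * χ p)) (x, y) ∂ν := by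
      have h1 : Δ f x = N f x - N' f x := rfl
      rw [h1, hJf, (happ f x).2, ← integral_sub (happ f x).1 hintD]
      refine integral_congr_ae (.of_forall fun y => ?_)
      by_cases hxy : (x, y) ∈ D
      · have : (x, y) ∉ Dᶜ := fun h => h hxy
        simp only [Set.indicator_of_mem hxy, Set.indicator_of_notMem this, sub_self]
      · have : (x, y) ∈ Dᶜ := hxy
        simp only [Set.indicator_of_mem this, Set.indicator_of_notMem hxy, sub_zero]
    have hbound : ‖Δ f x‖ₑ
        ≤ (‖f‖ₑ * c * w x) * ENNReal.ofReal (ε / (c + 1)) := by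
      rw [hdiff]
      refine (enorm_integral_le_lintegral_enorm _).trans ?_
      calc ∫⁻ y, ‖Dᶜ.indicator (fun p => (β p : ℂ) * (f p.2 * χ p)) (x, y)‖ₑ ∂ν
          ≤ ∫⁻ y, {y | m ≤ αw (x, y)}.indicator
              (fun y => (‖f‖ₑ * c * w x) * (αw (x, y) : ℝ≥0)) y ∂ν := by
            refine lintegral_mono fun y => ?_
            by_cases hxy : (x, y) ∈ D
            · have : (x, y) ∉ Dᶜ := fun h => h hxy
              simp only [Set.indicator_of_notMem this, enorm_zero, zero_le]
            · have h1 : (x, y) ∈ Dᶜ := hxy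
              have h2 : m ≤ αw (x, y) := not_lt.1 hxy
              replace h2 : y ∈ {y | m ≤ αw (x, y)} := h2
              simp only [Set.indicator_of_mem h1, Set.indicator_of_mem h2, enorm_mul]
              have h3 : ‖(β (x, y) : ℂ)‖ₑ ≤ α (x, y) := by
                have : ‖((β (x, y) : ℝ) : ℂ)‖₊ ≤ α (x, y) := by
                  refine le_trans (le_of_eq ?_) (hβα (x, y))
                  rw [Complex.nnnorm_real, Real.nnnorm_of_nonneg (β (x, y)).coe_nonneg]
                  rfl
                exact ENNReal.coe_le_coe.2 this
              have h4 : ‖χ (x, y)‖ₑ ≤ c := ENNReal.coe_le_coe.2 (hc (x, y))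
              have h5 : ((α (x, y) : ℝ≥0∞)) * w y = w x * (αw (x, y) : ℝ≥0) := by
                rw [← ENNReal.coe_mul, ← ENNReal.coe_mul, ENNReal.coe_inj]
                have hwx : w x ≠ 0 := (lt_of_lt_of_le one_pos (w.one_le' x)).ne'
                simp only [αw]
                field_simp
              calc ‖(β (x, y) : ℂ)‖ₑ * (‖f y‖ₑ * ‖χ (x, y)‖ₑ)
                  ≤ α (x, y) * ((‖f‖ₑ * w y) * c) := by
                    gcongr
                    exact f.enorm_apply_le y
                _ = ‖f‖ₑ * c * (α (x, y) * w y) := by ring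
                _ = _ := by rw [h5]; ring
        _ = (‖f‖ₑ * c * w x) * ∫⁻ y in {y | m ≤ αw (x, y)}, (αw (x, y) : ℝ≥0) ∂ν := by
            have hαx : Measurable fun y => αw (x, y) := hαw.comp measurable_prodMk_left
            rw [lintegral_indicator (measurableSet_le measurable_const hαx),
              lintegral_const_mul _ hαx.coe_nnreal_ennreal]
        _ ≤ _ := by gcongr; exact hm x
    have hreal : ‖Δ f x‖ ≤ (‖f‖ * c * w x) * (ε / (c + 1)) := by
      rw [← ofReal_norm, ← ofReal_norm, ← ENNReal.ofReal_coe_nnreal, ← ENNReal.ofReal_coe_nnreal,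
        ← ENNReal.ofReal_mul (by positivity), ← ENNReal.ofReal_mul (by positivity),
        ← ENNReal.ofReal_mul (by positivity)] at hbound
      exact (ENNReal.ofReal_le_ofReal_iff (by positivity)).1 hbound
    refine hreal.trans ?_
    have hcc : (c : ℝ) * (ε / (c + 1)) ≤ ε := by
      rw [mul_div_assoc', div_le_iff₀ (by positivity)]
      nlinarith [c.coe_nonneg]
    calc ‖f‖ * c * w x * (ε / (c + 1)) = ‖f‖ * w x * (c * (ε / (c + 1))) := by ring
      _ ≤ ‖f‖ * w x * ε := by gcongr
      _ = ε * ‖f‖ * w x := by ring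
  refine IsApproximable.of_limit fun ε hε => ?_
  -- Replacing both outer factors costs `δ ‖A‖ (‖N‖ + ‖N'‖)`, and `δ ≤ 1` gives `‖N'‖ ≤ ‖N‖ + 1`.
  obtain ⟨δ, hδ, hδ1, hδε⟩ : ∃ δ : ℝ, 0 < δ ∧ δ ≤ 1 ∧ δ * (‖A‖ * (2 * ‖N‖ + 1)) ≤ ε := by
    refine ⟨min 1 (ε / (‖A‖ * (2 * ‖N‖ + 1) + 1)), lt_min one_pos (by positivity),
      min_le_left _ _, ?_⟩
    calc min 1 (ε / (‖A‖ * (2 * ‖N‖ + 1) + 1)) * (‖A‖ * (2 * ‖N‖ + 1))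
        ≤ (ε / (‖A‖ * (2 * ‖N‖ + 1) + 1)) * (‖A‖ * (2 * ‖N‖ + 1) + 1) := by
          gcongr
          · exact min_le_right _ _
          · linarith
      _ = ε := div_mul_cancel₀ _ (by positivity)
  obtain ⟨J, hJ⟩ := htrunc δ hδ
  set N' : WeightedSpace w →L[ℂ] WeightedSpace w := J ∘L toL2 ν with hN'
  refine ⟨N' * A * N', ?_, ?_⟩
  · have h := ((isApproximable_toL2_comp ν (A ∘L J)).comp_right (toL2 (w := w) ν)).comp_left J
    exact h
  · have h : N * A * N - N' * A * N' = (N - N') * A * N + N' * A * (N - N') := by noncomm_ring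
    have hN'n : ‖N'‖ ≤ ‖N‖ + 1 := by
      have := norm_sub_norm_le N' N
      rw [norm_sub_rev] at this
      linarith
    rw [h]
    calc ‖(N - N') * A * N + N' * A * (N - N')‖
        ≤ ‖(N - N') * A * N‖ + ‖N' * A * (N - N')‖ := norm_add_le _ _
      _ ≤ ‖N - N'‖ * ‖A‖ * ‖N‖ + ‖N'‖ * ‖A‖ * ‖N - N'‖ := by
          gcongr <;>
          exact (norm_mul_le _ _).trans (mul_le_mul_of_nonneg_right (norm_mul_le _ _)
            (norm_nonneg _))
      _ ≤ δ * ‖A‖ * ‖N‖ + (‖N‖ + 1) * ‖A‖ * δ := by gcongr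
      _ = δ * (‖A‖ * (2 * ‖N‖ + 1)) := by ring
      _ ≤ ε := hδε

end AbsolutelyContinuous

/-! ### Hitting times of Markov chains -/

section Hitting

variable {E : Type*} [MeasurableSpace E]

/-- The one-step Markov property in integrated form. Both sides depend on finitely many coordinates,
so it reduces to the finite-dimensional laws, where the last kernel can be integrated out. -/
theorem lintegral_traj_succ {X : ℕ → Type*} [∀ n, MeasurableSpace (X n)]
    (κ : (n : ℕ) → Kernel ((i : Finset.Iic n) → X i) (X (n + 1))) [∀ n, IsMarkovKernel (κ n)]
    (x : (i : Finset.Iic 0) → X i) (n : ℕ) {g : ((i : Finset.Iic n) → X i) → ℝ≥0∞}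
    (hg : Measurable g) {f : X (n + 1) → ℝ≥0∞} (hf : Measurable f) :
    ∫⁻ ω, g (Preorder.frestrictLe n ω) * f (ω (n + 1)) ∂(Kernel.traj κ 0 x)
      = ∫⁻ ω, g (Preorder.frestrictLe n ω) * ∫⁻ y, f y ∂(κ n (Preorder.frestrictLe n ω))
        ∂(Kernel.traj κ 0 x) := by
  have hG : Measurable fun z : (i : Finset.Iic (n + 1)) → X i =>
      g (Preorder.frestrictLe₂ n.le_succ z) * f (z ⟨n + 1, Finset.mem_Iic.2 le_rfl⟩) := by
    fun_prop
  have hK : Measurable fun z : (i : Finset.Iic n) → X i => g z * ∫⁻ y, f y ∂(κ n z) :=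
    hg.mul hf.lintegral_kernel
  have h1 := lintegral_map (μ := Kernel.traj κ 0 x) hG
    (Preorder.measurable_frestrictLe (X := X) (n + 1))
  have h2 := lintegral_map (μ := Kernel.traj κ 0 x) hK
    (Preorder.measurable_frestrictLe (X := X) n)
  rw [Kernel.traj_map_frestrictLe_apply] at h1 h2
  refine h1.symm.trans (Eq.trans ?_ h2)
  rw [Kernel.partialTraj_succ_of_le (Nat.zero_le n), Kernel.map_apply _ (by fun_prop),
    lintegral_map hG (by fun_prop), Kernel.lintegral_comp _ _ _ (by fun_prop)]
  refine lintegral_congr fun z => ?_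
  rw [Kernel.lintegral_id_prod (by fun_prop), Kernel.map_apply _ (by fun_prop),
    lintegral_map (by fun_prop) (by fun_prop), ← lintegral_const_mul _ hf]
  refine lintegral_congr fun y => ?_
  congr 2
  · ext i
    have hi : i.1 ≤ n := Finset.mem_Iic.1 i.2
    simp [IicProdIoc_def, hi]
  · simp [IicProdIoc_def, MeasurableEquiv.piSingleton]

/-- The operator `f ↦ 1_{Cᶜ} P f`. -/
noncomputable def avoidOp (P : Kernel E E) (C : Set E) (f : E → ℝ≥0∞) : E → ℝ≥0∞ :=
  fun x => Cᶜ.indicator 1 x * ∫⁻ y, f y ∂(P x)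

variable {P : Kernel E E} {C : Set E}

theorem avoidOp_of_mem {x : E} (hx : x ∈ C) (f : E → ℝ≥0∞) : avoidOp P C f x = 0 := by
  have : x ∉ Cᶜ := fun h => h hx
  rw [avoidOp, Set.indicator_of_notMem this, zero_mul]

theorem avoidOp_of_notMem {x : E} (hx : x ∉ C) (f : E → ℝ≥0∞) :
    avoidOp P C f x = ∫⁻ y, f y ∂(P x) := by
  rw [avoidOp, Set.indicator_of_mem (Set.mem_compl hx), Pi.one_apply, one_mul]

theorem measurable_avoidOp (hC : MeasurableSet C) {f : E → ℝ≥0∞} (hf : Measurable f) :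
    Measurable (avoidOp P C f) :=
  (measurable_one.indicator hC.compl).mul hf.lintegral_kernel

theorem measurable_iterate_avoidOp (hC : MeasurableSet C) {f : E → ℝ≥0∞} (hf : Measurable f)
    (n : ℕ) : Measurable ((avoidOp P C)^[n] f) := by
  induction n with
  | zero => exact hf
  | succ n ih =>
    rw [Function.iterate_succ_apply']
    exact measurable_avoidOp hC ih

theorem avoidOp_mono : Monotone (avoidOp P C) := fun _ _ hfg _ =>
  mul_le_mul' le_rfl (lintegral_mono hfg)

theorem iterate_avoidOp_le {w : E → ℝ≥0∞} {a : ℝ≥0∞} (ha : a ≠ ∞)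
    (hw : ∀ x, x ∉ C → ∫⁻ y, w y ∂(P x) ≤ a * w x) (n : ℕ) (x : E) :
    (avoidOp P C)^[n] w x ≤ a ^ n * w x := by
  induction n generalizing x with
  | zero => simp
  | succ n ih =>
    rw [Function.iterate_succ_apply']
    by_cases hx : x ∈ C
    · rw [avoidOp_of_mem hx]; exact zero_le
    · rw [avoidOp_of_notMem hx]
      calc ∫⁻ y, (avoidOp P C)^[n] w y ∂(P x) ≤ ∫⁻ y, a ^ n * w y ∂(P x) := lintegral_mono ih
        _ = a ^ n * ∫⁻ y, w y ∂(P x) := lintegral_const_mul' _ _ (ENNReal.pow_ne_top ha)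
        _ ≤ a ^ n * (a * w x) := by gcongr; exact hw x hx
        _ = a ^ (n + 1) * w x := by ring

variable [IsMarkovKernel P]

instance (x : E) : IsProbabilityMeasure (chainLaw P x) := by
  unfold chainLaw; infer_instance

/-- The trajectories which avoid `C` before time `n`. -/
def avoidSet (C : Set E) (n : ℕ) : Set (ℕ → E) := {ω | ∀ i < n, ω i ∉ C}

theorem measurableSet_avoidSet (hC : MeasurableSet C) (n : ℕ) :
    MeasurableSet (avoidSet C n) := by
  have : avoidSet C n = ⋂ i, ⋂ _ : i < n, (fun ω : ℕ → E => ω i) ⁻¹' Cᶜ := by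
    ext ω; simp [avoidSet]
  rw [this]
  exact .iInter fun i => .iInter fun _ => measurable_pi_apply i hC.compl

theorem lintegral_chainLaw_eval_zero (x : E) {f : E → ℝ≥0∞} (hf : Measurable f) :
    ∫⁻ ω, f (ω 0) ∂(chainLaw P x) = f x := by
  have h := lintegral_map (μ := chainLaw P x)
    (f := fun z : (i : Finset.Iic 0) → E => f (z ⟨0, Finset.mem_Iic.2 le_rfl⟩)) (by fun_prop)
    (Preorder.measurable_frestrictLe (X := fun _ => E) 0)
  rw [chainLaw, Kernel.traj_map_frestrictLe_apply, Kernel.partialTraj_self, Kernel.id_apply,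
    lintegral_dirac' _ (by fun_prop)] at h
  exact h.symm

theorem lintegral_avoidSet (hC : MeasurableSet C) (n : ℕ) {f : E → ℝ≥0∞} (hf : Measurable f)
    (x : E) :
    ∫⁻ ω, (avoidSet C n).indicator 1 ω * f (ω n) ∂(chainLaw P x) = (avoidOp P C)^[n] f x := by
  induction n generalizing f with
  | zero =>
    have : avoidSet C 0 = Set.univ := by ext; simp [avoidSet]
    simp only [this, Set.indicator_univ, Pi.one_apply, one_mul]
    exact lintegral_chainLaw_eval_zero x hf
  | succ n ih =>
    -- The last transition is peeled off: integrating out the coordinate `n + 1` turns `f` into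
    -- `1_{Cᶜ} P f` at time `n`, so the induction has to vary `f` and not `x`.
    rw [Function.iterate_succ_apply, ← ih (measurable_avoidOp hC hf)]
    let G : Set ((i : Finset.Iic n) → E) := {z | ∀ i, z i ∉ C}
    have hG : MeasurableSet G := by
      have : G = ⋂ i, (fun z : (i : Finset.Iic n) → E => z i) ⁻¹' Cᶜ := by
        ext z; simp [G]
      rw [this]
      exact .iInter fun i => measurable_pi_apply i hC.compl
    have hmem : ∀ ω : ℕ → E, Preorder.frestrictLe n ω ∈ G ↔ ω ∈ avoidSet C (n + 1) := by
      intro ω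
      refine ⟨fun h i hi => h ⟨i, Finset.mem_Iic.2 (by omega)⟩, fun h i => h i.1 ?_⟩
      have := Finset.mem_Iic.1 i.2
      omega
    have hind : ∀ ω : ℕ → E, (avoidSet C (n + 1)).indicator (1 : (ℕ → E) → ℝ≥0∞) ω
        = G.indicator 1 (Preorder.frestrictLe n ω) := by
      intro ω
      by_cases h : ω ∈ avoidSet C (n + 1)
      · rw [Set.indicator_of_mem h, Set.indicator_of_mem ((hmem ω).2 h)]; rfl
      · rw [Set.indicator_of_notMem h, Set.indicator_of_notMem fun h' => h ((hmem ω).1 h')]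
    have hone := lintegral_traj_succ (X := fun _ => E)
      (fun n => P.comap (fun z : (i : Finset.Iic n) → E => z ⟨n, Finset.mem_Iic.2 le_rfl⟩)
      (measurable_pi_apply _)) (fun _ => x) n (g := G.indicator 1)
      (measurable_one.indicator hG) hf
    simp only [hind]
    refine hone.trans (lintegral_congr fun ω => ?_)
    rw [← hind]
    have hval : ∫⁻ y, f y ∂(P.comap (fun z : (i : Finset.Iic n) → E =>
        z ⟨n, Finset.mem_Iic.2 le_rfl⟩) (measurable_pi_apply _) (Preorder.frestrictLe n ω))
        = ∫⁻ y, f y ∂(P (ω n)) := by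
      rw [Kernel.comap_apply]; rfl
    rw [hval]
    by_cases hn : ω n ∈ C
    · have : ω ∉ avoidSet C (n + 1) := fun h => h n (Nat.lt_succ_self n) hn
      rw [Set.indicator_of_notMem this, avoidOp_of_mem hn, zero_mul, mul_zero]
    · rw [avoidOp_of_notMem hn]
      congr 1
      have : ω ∈ avoidSet C (n + 1) ↔ ω ∈ avoidSet C n := by
        refine ⟨fun h i hi => h i (by omega), fun h i hi => ?_⟩
        rcases Nat.lt_succ_iff_lt_or_eq.1 hi with h' | rfl
        · exact h i h'
        · exact hn
      by_cases h : ω ∈ avoidSet C n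
      · rw [Set.indicator_of_mem h, Set.indicator_of_mem (this.2 h)]
      · rw [Set.indicator_of_notMem h, Set.indicator_of_notMem fun h' => h (this.1 h')]

/-- The `n`-th summand is `r^n` when `σ_C = n` and `0` otherwise. Finiteness of `σ_C` is assumed
because the series would give `0` at infinity, unlike `powTop` for `r ≥ 1`. -/
theorem powTop_hitTime {E : Type*} {C : Set E} {ω : ℕ → E} (hω : ∃ j, ω j ∈ C) (r : ℝ≥0∞) :
    powTop r (hitTime C ω)
      = ∑' n, r ^ n * ((avoidSet C n).indicator 1 ω * C.indicator 1 (ω n)) := by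
  classical
  have hex : ∃ j, 0 ≤ j ∧ ω j ∈ C := by simpa using hω
  set N := Nat.find hω with hN
  have hhit : hitTime C ω = (N : WithTop ℕ) := by
    have h1 : {i : ℕ | 0 ≤ i ∧ ω i ∈ C} = {i | ω i ∈ C} := by ext; simp
    have h2 : sInf {i : ℕ | ω i ∈ C} = N := Nat.sInf_def hω
    rw [hitTime, hittingAfter, if_pos hex, h1, h2]
    rfl
  rw [hhit, tsum_eq_single N]
  · have h1 : ω ∈ avoidSet C N := fun i hi => Nat.find_min hω hi
    have h2 : ω N ∈ C := Nat.find_spec hω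
    rw [Set.indicator_of_mem h1, Set.indicator_of_mem h2]
    simp [powTop]
  · intro n hn
    rcases lt_or_gt_of_ne hn with h | h
    · have : ω n ∉ C := Nat.find_min hω h
      rw [Set.indicator_of_notMem this, mul_zero, mul_zero]
    · have : ω ∉ avoidSet C n := fun h' => h' N h (Nat.find_spec hω)
      rw [Set.indicator_of_notMem this, zero_mul, mul_zero]

variable {w : E → ℝ≥0∞} {r₁ : ℝ≥0}

/-- As `w ≥ 1`, the drift off `C` makes the probability of avoiding `C` before time `n` at most
`r₁^{-n} w(x)`, which tends to `0`. -/
theorem ae_hits (hC : MeasurableSet C) (hr₁ : 1 < r₁) (hw1 : ∀ x, 1 ≤ w x) (hwtop : ∀ x, w x ≠ ∞)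
    (hw : ∀ x, x ∉ C → ∫⁻ y, w y ∂(P x) ≤ (r₁ : ℝ≥0∞)⁻¹ * w x) (x : E) :
    ∀ᵐ ω ∂(chainLaw P x), ∃ j, ω j ∈ C := by
  have hr0 : (r₁ : ℝ≥0∞) ≠ 0 := by
    have : r₁ ≠ 0 := (zero_lt_one.trans hr₁).ne'
    exact_mod_cast this
  have hle : ∀ n, chainLaw P x {ω | ¬ ∃ j, ω j ∈ C} ≤ ((r₁ : ℝ≥0∞)⁻¹) ^ n * w x := by
    intro n
    calc chainLaw P x {ω | ¬ ∃ j, ω j ∈ C} ≤ chainLaw P x (avoidSet C n) := by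
          refine measure_mono fun ω hω i _ hi => hω ⟨i, hi⟩
      _ = ∫⁻ ω, (avoidSet C n).indicator 1 ω * (1 : E → ℝ≥0∞) (ω n) ∂(chainLaw P x) := by
          simp only [Pi.one_apply, mul_one]
          rw [lintegral_indicator_one (measurableSet_avoidSet hC n)]
      _ = (avoidOp P C)^[n] 1 x := lintegral_avoidSet hC n measurable_one x
      _ ≤ (avoidOp P C)^[n] w x := (avoidOp_mono.iterate n) (fun y => hw1 y) x
      _ ≤ _ := iterate_avoidOp_le (ENNReal.inv_ne_top.2 hr0) hw n x
  have hlim : Tendsto (fun n : ℕ => ((r₁ : ℝ≥0∞)⁻¹) ^ n * w x) atTop (𝓝 (0 * w x)) := by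
    refine ENNReal.Tendsto.mul_const ?_ (Or.inr (hwtop x))
    refine ENNReal.tendsto_pow_atTop_nhds_zero_of_lt_one ?_
    rw [ENNReal.inv_lt_one]
    exact_mod_cast hr₁
  rw [zero_mul] at hlim
  exact le_antisymm (ge_of_tendsto' hlim hle) zero_le

theorem hitGenFun_eq_tsum (hC : MeasurableSet C) (hr₁ : 1 < r₁) (hw1 : ∀ x, 1 ≤ w x)
    (hwtop : ∀ x, w x ≠ ∞) (hw : ∀ x, x ∉ C → ∫⁻ y, w y ∂(P x) ≤ (r₁ : ℝ≥0∞)⁻¹ * w x)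
    (r : ℝ≥0∞) (x : E) :
    hitGenFun P C r x = ∑' n, r ^ n * (avoidOp P C)^[n] (C.indicator 1) x := by
  have hind : Measurable (C.indicator (1 : E → ℝ≥0∞)) := measurable_one.indicator hC
  have hterm : ∀ n, Measurable fun ω : ℕ → E =>
      (avoidSet C n).indicator (1 : (ℕ → E) → ℝ≥0∞) ω * C.indicator (1 : E → ℝ≥0∞) (ω n) :=
    fun n => (measurable_one.indicator (measurableSet_avoidSet hC n)).mul
      (hind.comp (measurable_pi_apply n))
  have h1 : hitGenFun P C r x
      = ∫⁻ ω, ∑' n, r ^ n * ((avoidSet C n).indicator 1 ω * C.indicator 1 (ω n))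
        ∂(chainLaw P x) := by
    refine lintegral_congr_ae ?_
    filter_upwards [ae_hits hC hr₁ hw1 hwtop hw x] with ω hω
    exact powTop_hitTime hω r
  rw [h1, lintegral_tsum fun n => ((hterm n).const_mul _).aemeasurable]
  refine tsum_congr fun n => ?_
  rw [lintegral_const_mul _ (hterm n), lintegral_avoidSet hC n hind]

theorem hitGenFun_of_mem (hC : MeasurableSet C) (r : ℝ≥0∞) {x : E} (hx : x ∈ C) :
    hitGenFun P C r x = 1 := by
  have hmeas : Measurable fun ω : ℕ → E => Cᶜ.indicator (1 : E → ℝ≥0∞) (ω 0) :=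
    (measurable_one.indicator hC.compl).comp (measurable_pi_apply 0)
  -- Singletons need not be measurable, so `X₀ = x` is used only through the event that `X₀` lies in
  -- `C`.
  have hae : ∀ᵐ ω ∂(chainLaw P x), ω 0 ∈ C := by
    have h := lintegral_chainLaw_eval_zero (P := P) x (measurable_one.indicator hC.compl)
    rw [Set.indicator_of_notMem (fun h : x ∈ Cᶜ => h hx), lintegral_eq_zero_iff hmeas] at h
    filter_upwards [h] with ω hω
    by_contra hcon
    rw [Set.indicator_of_mem (Set.mem_compl hcon)] at hω
    exact one_ne_zero hω
  have h1 : hitGenFun P C r x = ∫⁻ _, 1 ∂(chainLaw P x) := by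
    refine lintegral_congr_ae ?_
    filter_upwards [hae] with ω hω
    rw [powTop_hitTime ⟨0, hω⟩, tsum_eq_single 0]
    · have : ω ∈ avoidSet C 0 := fun i hi => absurd hi (Nat.not_lt_zero i)
      rw [Set.indicator_of_mem this, Set.indicator_of_mem hω]
      simp
    · intro n hn
      have : ω ∉ avoidSet C n := fun h => h 0 (Nat.pos_of_ne_zero hn) hω
      rw [Set.indicator_of_notMem this, zero_mul, mul_zero]
  rw [h1, lintegral_one, measure_univ]

/-- First-step analysis: off `C` the term of index `0` vanishes, and shifting the index extracts one
factor `r` and one application of `P`. -/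
theorem hitGenFun_of_notMem (hC : MeasurableSet C) (hr₁ : 1 < r₁) (hw1 : ∀ x, 1 ≤ w x)
    (hwtop : ∀ x, w x ≠ ∞) (hw : ∀ x, x ∉ C → ∫⁻ y, w y ∂(P x) ≤ (r₁ : ℝ≥0∞)⁻¹ * w x)
    (r : ℝ≥0∞) {x : E} (hx : x ∉ C) :
    hitGenFun P C r x = r * ∫⁻ y, hitGenFun P C r y ∂(P x) := by
  have hind : Measurable (C.indicator (1 : E → ℝ≥0∞)) := measurable_one.indicator hC
  have hD := measurable_iterate_avoidOp (P := P) hC hind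
  simp only [hitGenFun_eq_tsum hC hr₁ hw1 hwtop hw]
  rw [tsum_eq_zero_add' ENNReal.summable,
    lintegral_tsum fun n => ((hD n).const_mul _).aemeasurable, ← ENNReal.tsum_mul_left]
  simp only [Function.iterate_zero, id_eq, Set.indicator_of_notMem hx, mul_zero, zero_add]
  refine tsum_congr fun n => ?_
  rw [Function.iterate_succ_apply', avoidOp_of_notMem hx, lintegral_const_mul _ (hD n), pow_succ']
  ring

theorem powTop_mono {r s : ℝ≥0∞} (hrs : r ≤ s) (t : WithTop ℕ) : powTop r t ≤ powTop s t := by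
  induction t with
  | top => exact limsup_le_limsup (.of_forall fun n => pow_le_pow_left' hrs n)
  | coe n => exact pow_le_pow_left' hrs n

theorem hitGenFun_mono {r s : ℝ≥0∞} (hrs : r ≤ s) (x : E) :
    hitGenFun P C r x ≤ hitGenFun P C s x :=
  lintegral_mono fun _ => powTop_mono hrs _

/-- Up to time `σ_C`, `r₁^n w(X_n)` is a supermartingale, and `w ≥ 1` on `C`. Instead of optional
stopping, the partial sums are bounded by `w`, by induction on their length at all starting points
at once. -/
theorem hitGenFun_le (hC : MeasurableSet C) (hr₁ : 1 < r₁) (hw1 : ∀ x, 1 ≤ w x)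
    (hwtop : ∀ x, w x ≠ ∞) (hw : ∀ x, x ∉ C → ∫⁻ y, w y ∂(P x) ≤ (r₁ : ℝ≥0∞)⁻¹ * w x)
    {r : ℝ≥0∞} (hr : r ≤ r₁) (x : E) : hitGenFun P C r x ≤ w x := by
  refine (hitGenFun_mono hr x).trans ?_
  have hr0 : (r₁ : ℝ≥0∞) ≠ 0 := by
    have : r₁ ≠ 0 := (zero_lt_one.trans hr₁).ne'
    exact_mod_cast this
  have hind : Measurable (C.indicator (1 : E → ℝ≥0∞)) := measurable_one.indicator hC
  have hD := measurable_iterate_avoidOp (P := P) hC hind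
  rw [hitGenFun_eq_tsum hC hr₁ hw1 hwtop hw, ENNReal.tsum_eq_iSup_nat]
  refine iSup_le fun N => ?_
  induction N generalizing x with
  | zero => simp
  | succ N ih =>
    rw [Finset.sum_range_succ']
    by_cases hx : x ∈ C
    · have h0 : ∀ n ∈ Finset.range N,
          (r₁ : ℝ≥0∞) ^ (n + 1) * (avoidOp P C)^[n + 1] (C.indicator 1) x = 0 := fun n _ => by
        rw [Function.iterate_succ_apply', avoidOp_of_mem hx, mul_zero]
      rw [Finset.sum_eq_zero h0, Function.iterate_zero, id_eq, Set.indicator_of_mem hx]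
      simpa using hw1 x
    · have h1 : ∀ n ∈ Finset.range N,
          (r₁ : ℝ≥0∞) ^ (n + 1) * (avoidOp P C)^[n + 1] (C.indicator 1) x
            = r₁ * ∫⁻ y, (r₁ : ℝ≥0∞) ^ n * (avoidOp P C)^[n] (C.indicator 1) y ∂(P x) :=
          fun n _ => by
        rw [Function.iterate_succ_apply', avoidOp_of_notMem hx, lintegral_const_mul _ (hD n),
          pow_succ']
        ring
      rw [Finset.sum_congr rfl h1, Function.iterate_zero, id_eq, Set.indicator_of_notMem hx,
        mul_zero, add_zero, ← Finset.mul_sum,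
        ← lintegral_finsetSum _ fun n _ => (hD n).const_mul _]
      calc (r₁ : ℝ≥0∞) * ∫⁻ y, ∑ n ∈ Finset.range N,
            (r₁ : ℝ≥0∞) ^ n * (avoidOp P C)^[n] (C.indicator 1) y ∂(P x)
          ≤ r₁ * ∫⁻ y, w y ∂(P x) := by gcongr with y; exact ih y
        _ ≤ r₁ * ((r₁ : ℝ≥0∞)⁻¹ * w x) := by gcongr; exact hw x hx
        _ = w x := by
          rw [← mul_assoc, ENNReal.mul_inv_cancel hr0 ENNReal.coe_ne_top, one_mul]

end Hitting

/-! ### The residual kernel -/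

section Residual

variable {E : Type*} [MeasurableSpace E]

theorem exists_kernel_add_eq (P N : Kernel E E) [IsFiniteKernel P] (hle : ∀ x, N x ≤ P x) :
    ∃ R : Kernel E E, IsFiniteKernel R ∧ ∀ x, P x = N x + R x := by
  have hN : ∀ x, IsFiniteMeasure (N x) := fun x =>
    ⟨lt_of_le_of_lt (hle x Set.univ) (measure_lt_top _ _)⟩
  let R : Kernel E E :=
    { toFun := fun x => P x - N x
      measurable' := Measure.measurable_of_measurable_coe _ fun s hs => by
        have h : (fun x => (P x - N x) s) = fun x => P x s - N x s := by
          funext x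
          have := hN x
          exact Measure.sub_apply hs (hle x)
        rw [h]
        exact (P.measurable_coe hs).sub (N.measurable_coe hs) }
  have hR : ∀ x, P x = N x + R x := fun x => by
    have := hN x
    rw [add_comm]
    exact (Measure.sub_add_cancel_of_le (hle x)).symm
  refine ⟨R, ⟨⟨P.bound, P.bound_lt_top, fun x => ?_⟩⟩, hR⟩
  refine le_trans ?_ (P.measure_le_bound x Set.univ)
  rw [hR x, Measure.add_apply]
  exact le_add_self

variable {C : Set E} {b : ℝ≥0} {ν : Measure E} [IsProbabilityMeasure ν] {α : E × E → ℝ≥0}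

/-- The density `b 1_C(x) α(x, y)`. -/
noncomputable def minorant (C : Set E) (b : ℝ≥0) (α : E × E → ℝ≥0) (p : E × E) : ℝ≥0 :=
  C.indicator (fun _ => b) p.1 * α p

theorem measurable_minorant (hC : MeasurableSet C) (hα : Measurable α) :
    Measurable (minorant C b α) :=
  ((measurable_const.indicator hC).comp measurable_fst).mul hα

theorem minorant_le {E : Type*} {C : Set E} {b : ℝ≥0} {α : E × E → ℝ≥0} (hb : b ≤ 1)
    (p : E × E) : minorant C b α p ≤ α p := by
  refine mul_le_of_le_one_left' ?_
  exact Set.indicator_le' (fun _ _ => hb) (fun _ _ => zero_le) p.1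

theorem densityKernel_minorant_apply (hC : MeasurableSet C) (hα : Measurable α) (x : E)
    {A : Set E} (hA : MeasurableSet A) :
    densityKernel ν (minorant C b α) x A = b * C.indicator 1 x * densityKernel ν α x A := by
  rw [densityKernel_apply ν (measurable_minorant hC hα), densityKernel_apply ν hα,
    withDensity_apply _ hA, withDensity_apply _ hA, ← lintegral_const_mul' _ _ (by
      by_cases hx : x ∈ C <;> simp [hx])]
  refine lintegral_congr fun y => ?_
  by_cases hx : x ∈ C <;> simp [minorant, hx]

/-- `R` is the part of `P` used by the operators; `P₀` is its normalisation, as `R` has mass `1 - b`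
on `C` and `1` elsewhere. For `b = 1`, `R` vanishes on `C` and the Dirac kernel is a convention. -/
theorem exists_residualKernel (P T : Kernel E E) [IsMarkovKernel P] [IsMarkovKernel T]
    (hC : MeasurableSet C) (hb : b ≤ 1) {N : Kernel E E}
    (hN : ∀ x A, MeasurableSet A → N x A = b * C.indicator 1 x * T x A) (hle : ∀ x, N x ≤ P x) :
    ∃ R P₀ : Kernel E E, IsFiniteKernel R ∧ (∀ x, P x = N x + R x) ∧
      IsMarkovKernel P₀ ∧ IsResidualKernel P T C b P₀ ∧
      (∀ x ∈ C, R x = (1 - (b : ℝ≥0∞)) • P₀ x) ∧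
      (b < 1 → ∀ x ∈ C, P₀ x ≤ (1 - (b : ℝ≥0∞))⁻¹ • P x) ∧
      (b = 1 → ∀ x ∈ C, P₀ x = Measure.dirac x) := by
  obtain ⟨R, hRfin, hR⟩ := exists_kernel_add_eq P N hle
  have hbtop : (1 - (b : ℝ≥0∞)) ≠ ∞ := ENNReal.sub_ne_top ENNReal.one_ne_top
  have hRA : ∀ x A, MeasurableSet A → R x A = P x A - b * C.indicator 1 x * T x A := by
    intro x A hA
    have hfin : N x A ≠ ∞ := (lt_of_le_of_lt (hle x A) (measure_lt_top _ _)).ne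
    rw [← hN x A hA, hR x, Measure.add_apply, ENNReal.add_sub_cancel_left hfin]
  have hRC : ∀ x ∈ C, R x Set.univ = 1 - b := by
    intro x hx
    rw [hRA x _ .univ, Set.indicator_of_mem hx]
    simp
  have hRnC : ∀ x, x ∉ C → R x Set.univ = 1 := by
    intro x hx
    rw [hRA x _ .univ, Set.indicator_of_notMem hx]
    simp
  classical
  let K : Kernel E E := if b = 1 then Kernel.id else R.withDensity fun _ _ => (1 - (b : ℝ≥0∞))⁻¹
  have hK1 : b = 1 → ∀ x, K x = Measure.dirac x := fun h x => by
    simp only [K, if_pos h, Kernel.id_apply]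
  have hKb : b < 1 → ∀ x, K x = (1 - (b : ℝ≥0∞))⁻¹ • R x := fun h x => by
    simp only [K, if_neg h.ne]
    rw [Kernel.withDensity_apply _ (by fun_prop), withDensity_const]
  have hb0 : b < 1 → (1 - (b : ℝ≥0∞)) ≠ 0 := fun h => by
    have : (b : ℝ≥0∞) < 1 := by exact_mod_cast h
    exact (tsub_pos_of_lt this).ne'
  have hP0C : ∀ x ∈ C, Kernel.piecewise hC K R x = K x := fun x hx => by
    rw [Kernel.piecewise_apply, if_pos hx]
  have hP0nC : ∀ x, x ∉ C → Kernel.piecewise hC K R x = R x := fun x hx => by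
    rw [Kernel.piecewise_apply, if_neg hx]
  refine ⟨R, Kernel.piecewise hC K R, hRfin, hR, ⟨fun x => ⟨?_⟩⟩,
    fun x A hA => ⟨fun h => ?_, fun h hx => ?_⟩, fun x hx => ?_, fun h x hx => ?_, fun h x hx => ?_⟩
  · by_cases hx : x ∈ C
    · rw [hP0C x hx]
      rcases hb.lt_or_eq with h | h
      · rw [hKb h, Measure.smul_apply, hRC x hx, smul_eq_mul, ENNReal.inv_mul_cancel (hb0 h) hbtop]
      · rw [hK1 h]; exact measure_univ
    · rw [hP0nC x hx, hRnC x hx]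
  · by_cases hx : x ∈ C
    · have hb1 : b < 1 := h.resolve_right fun h' => h' hx
      rw [hP0C x hx, hKb hb1, Measure.smul_apply, smul_eq_mul, hRA x A hA, Set.indicator_of_mem hx,
        Pi.one_apply, mul_one]
    · rw [hP0nC x hx, hRA x A hA, Set.indicator_of_notMem hx]
      simp
  · rw [hP0C x hx, hK1 h, Measure.dirac_apply' _ hA]
  · rw [hP0C x hx]
    rcases hb.lt_or_eq with h | h
    · rw [hKb h, smul_smul, ENNReal.mul_inv_cancel (hb0 h) hbtop, one_smul]
    · have h0 : R x = 0 := by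
        rw [← Measure.measure_univ_eq_zero, hRC x hx, h]
        simp
      rw [h0, h]
      simp
  · rw [hP0C x hx, hKb h, hR x]
    gcongr
    exact Measure.le_add_left le_rfl
  · rw [hP0C x hx, hK1 h]

end Residual

/-! ### Iterates of kernel operators -/

section Iterates

variable {E : Type*} [MeasurableSpace E] {w : WeightFunction E}

open WeightedSpace

/-- Used twice: with `a^n w + d_n` to bound the powers of `P`, and with `κ^n φ` to get the rate of
the residual operator. -/
theorem IsKernelOperator.enorm_pow_apply_le {Q : Kernel E E} {χ : E × E → ℂ}
    {T : WeightedSpace w →L[ℂ] WeightedSpace w} (hT : IsKernelOperator Q χ T) {c : ℝ≥0}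
    (hc : ∀ p, ‖χ p‖ ≤ c) {φ : ℕ → E → ℝ≥0∞} (h0 : ∀ x, (w x : ℝ≥0∞) ≤ φ 0 x)
    (hφ : ∀ n x, c * ∫⁻ y, φ n y ∂(Q x) ≤ φ (n + 1) x) (f : WeightedSpace w) (n : ℕ) (x : E) :
    ‖(T ^ n) f x‖ₑ ≤ ‖f‖ₑ * φ n x := by
  induction n generalizing x with
  | zero =>
    refine (f.enorm_apply_le x).trans ?_
    gcongr
    exact h0 x
  | succ n ih =>
    rw [pow_succ', mul_apply_eq_comp]
    refine (hT.enorm_apply_le hc ih x).trans ?_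
    rw [lintegral_const_mul' _ _ enorm_ne_top]
    calc (c : ℝ≥0∞) * (‖f‖ₑ * ∫⁻ y, φ n y ∂(Q x)) = ‖f‖ₑ * (c * ∫⁻ y, φ n y ∂(Q x)) := by ring
      _ ≤ _ := by gcongr; exact hφ n x

theorem opNorm_le_of_enorm_apply_le {T : WeightedSpace w →L[ℂ] WeightedSpace w} {M : ℝ≥0}
    (h : ∀ f x, ‖T f x‖ₑ ≤ ‖f‖ₑ * (M * w x)) : ‖T‖ ≤ M := by
  refine opNorm_le_of_apply_le M.coe_nonneg fun f x => ?_
  have h1 := h f x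
  rw [enorm_eq_nnnorm, enorm_eq_nnnorm] at h1
  have h2 : ‖T f x‖₊ ≤ ‖f‖₊ * (M * w x) := by exact_mod_cast h1
  have h3 : ‖T f x‖ ≤ ‖f‖ * (M * w x) := by exact_mod_cast h2
  linarith

theorem spectralRadius_le_one_of_pow_bounded {B : Type*} [NormedAddCommGroup B] [NormedSpace ℂ B]
    [CompleteSpace B] [Nontrivial B] {T : B →L[ℂ] B} {M : ℝ≥0} (h : ∀ n, ‖T ^ n‖ ≤ M) :
    spectralRadius ℂ T ≤ 1 := by
  by_contra! hlt
  obtain ⟨s, hs1, hs⟩ := ENNReal.lt_iff_exists_nnreal_btwn.1 hlt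
  have hs1' : 1 < s := by exact_mod_cast hs1
  obtain ⟨n, hn⟩ := pow_unbounded_of_one_lt M hs1'
  have h1 : (s : ℝ≥0∞) ^ n ≤ M := by
    calc (s : ℝ≥0∞) ^ n ≤ spectralRadius ℂ T ^ n := by gcongr
      _ ≤ spectralRadius ℂ (T ^ n) := spectrum.spectralRadius_pow_le' T n
      _ ≤ ‖T ^ n‖₊ := spectrum.spectralRadius_le_nnnorm _
      _ ≤ M := by
        have : ‖T ^ n‖₊ ≤ M := h n
        exact_mod_cast this
  have h2 : s ^ n ≤ M := by exact_mod_cast h1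
  exact absurd h2 hn.not_ge

/-- The constant function `1`, as an element of `𝓑_w`. -/
noncomputable def oneFun (w : WeightFunction E) : WeightedSpace w :=
  ⟨fun _ => 1, measurable_const, 1, fun x => by
    rw [norm_one, div_le_one (weight_pos w x)]
    exact_mod_cast w.one_le' x⟩

theorem oneFun_apply (x : E) : oneFun w x = 1 := rfl

theorem oneFun_ne_zero [Nonempty E] : oneFun w ≠ 0 := by
  intro h
  obtain ⟨x⟩ := ‹Nonempty E›
  have h1 : (oneFun w) x = (0 : WeightedSpace w) x := by rw [h]
  exact one_ne_zero h1

theorem one_le_spectralRadius [Nonempty E] {P : Kernel E E} [IsMarkovKernel P]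
    {T : WeightedSpace w →L[ℂ] WeightedSpace w} (hT : IsKernelOperator P 1 T) :
    1 ≤ spectralRadius ℂ T := by
  have hfix : T (oneFun w) = oneFun w := ext_apply fun x => by
    rw [(hT _ x).2]
    simp [oneFun_apply]
  have hmem : (1 : ℂ) ∈ spectrum ℂ T := by
    rw [spectrum.mem_iff, ContinuousLinearMap.isUnit_iff_bijective]
    intro hbij
    refine oneFun_ne_zero (w := w) (hbij.1 ?_)
    rw [map_zero, map_one, sub_apply, one_apply_eq_self, hfix, sub_self]
  have := le_iSup₂ (f := fun (k : ℂ) (_ : k ∈ spectrum ℂ T) => (‖k‖₊ : ℝ≥0∞)) 1 hmem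
  simpa [spectralRadius] using this

/-- Constants are fixed, so `1` is an eigenvalue. Iterating `Pw ≤ a (w + η)` with `a = r₁⁻¹ < 1`
gives `P^n w ≤ a^n w + aη/(1-a)`, so the powers are bounded. -/
theorem spectralRadius_eq_one [Nonempty E] {P : Kernel E E} [IsMarkovKernel P] {r₁ η : ℝ≥0}
    (hr₁ : 1 < r₁)
    (drift : ∀ x, ∫⁻ y, (w y : ℝ≥0∞) ∂(P x) ≤ (r₁ : ℝ≥0∞)⁻¹ * (w x + η))
    {T : WeightedSpace w →L[ℂ] WeightedSpace w} (hT : IsKernelOperator P 1 T) :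
    spectralRadius ℂ T = 1 := by
  refine le_antisymm ?_ (one_le_spectralRadius hT)
  have : Nontrivial (WeightedSpace w) := ⟨⟨_, _, oneFun_ne_zero⟩⟩
  set a : ℝ≥0∞ := (r₁ : ℝ≥0∞)⁻¹ with ha
  have hr0 : (r₁ : ℝ≥0∞) ≠ 0 := by
    have : r₁ ≠ 0 := (zero_lt_one.trans hr₁).ne'
    exact_mod_cast this
  have ha1 : a < 1 := by
    rw [ha, ENNReal.inv_lt_one]
    exact_mod_cast hr₁
  have hatop : a ≠ ∞ := (ha1.trans ENNReal.one_lt_top).ne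
  set d : ℕ → ℝ≥0∞ := fun n => a * η * ∑ i ∈ Finset.range n, a ^ i with hd
  have hK : a * η * (1 - a)⁻¹ ≠ ∞ := ENNReal.mul_ne_top (ENNReal.mul_ne_top hatop
    ENNReal.coe_ne_top) (ENNReal.inv_ne_top.2 (tsub_pos_of_lt ha1).ne')
  obtain ⟨K, hK⟩ : ∃ K : ℝ≥0, (K : ℝ≥0∞) = a * η * (1 - a)⁻¹ := ⟨_, ENNReal.coe_toNNReal hK⟩
  have hdK : ∀ n, d n ≤ K := fun n => by
    rw [hK, ← ENNReal.tsum_geometric]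
    exact mul_le_mul' le_rfl (ENNReal.sum_le_tsum _)
  have hpow : ∀ f n x, ‖(T ^ n) f x‖ₑ ≤ ‖f‖ₑ * (a ^ n * w x + d n) := by
    refine hT.enorm_pow_apply_le (c := 1) (φ := fun n x => a ^ n * w x + d n) (fun p => by simp)
      (fun x => by simp [hd]) (fun n x => ?_)
    rw [ENNReal.coe_one, one_mul, lintegral_add_right _ measurable_const, lintegral_const,
      measure_univ, mul_one, lintegral_const_mul' _ _ (ENNReal.pow_ne_top hatop)]
    calc a ^ n * ∫⁻ y, (w y : ℝ≥0∞) ∂(P x) + d n ≤ a ^ n * (a * (w x + η)) + d n := by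
          gcongr; exact drift x
      _ = a ^ (n + 1) * w x + d (n + 1) := by
          simp only [hd, Finset.sum_range_succ]; ring
  refine spectralRadius_le_one_of_pow_bounded (M := 1 + K) fun n =>
    opNorm_le_of_enorm_apply_le fun f x => (hpow f n x).trans ?_
  have hw1 : (1 : ℝ≥0∞) ≤ w x := by exact_mod_cast w.one_le' x
  gcongr
  calc a ^ n * w x + d n ≤ 1 * w x + K * w x := by
        refine add_le_add (mul_le_mul' (pow_le_one' ha1.le n) le_rfl) ?_
        exact (hdK n).trans (le_mul_of_one_le_right' hw1)
    _ = ((1 + K : ℝ≥0) : ℝ≥0∞) * w x := by push_cast; ring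

end Iterates

/-! ### The rate of contraction of the residual kernel -/

section Rate

variable {E : Type*} [MeasurableSpace E] {w : WeightFunction E} {C : Set E} {b r₁ η : ℝ≥0}
  {P R P₀ : Kernel E E} [IsMarkovKernel P]

/-- The drift condition outside `C`. -/
def DriftOff (P : Kernel E E) (C : Set E) (w : WeightFunction E) (r₁ : ℝ≥0) : Prop :=
  ∀ x, x ∉ C → ∫⁻ y, (w y : ℝ≥0∞) ∂(P x) ≤ (r₁ : ℝ≥0∞)⁻¹ * w x

/-- The drift condition on `C`. -/
def DriftOn (P : Kernel E E) (C : Set E) (w : WeightFunction E) (r₁ η : ℝ≥0) : Prop :=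
  ∀ x, x ∈ C → ∫⁻ y, (w y : ℝ≥0∞) ∂(P x) ≤ (r₁ : ℝ≥0∞)⁻¹ * η

theorem one_le_coe_weight (w : WeightFunction E) (x : E) : (1 : ℝ≥0∞) ≤ w x := by
  exact_mod_cast w.one_le' x

theorem DriftOff.hitGenFun_le (h : DriftOff P C w r₁) (hC : MeasurableSet C) (hr₁ : 1 < r₁)
    {r : ℝ≥0∞} (hr : r ≤ r₁) (x : E) : hitGenFun P C r x ≤ w x :=
  MarkovQuasiCompact.hitGenFun_le hC hr₁ (one_le_coe_weight w) (fun _ => ENNReal.coe_ne_top) h hr x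

theorem DriftOff.hitGenFun_of_notMem (h : DriftOff P C w r₁) (hC : MeasurableSet C)
    (hr₁ : 1 < r₁) (r : ℝ≥0∞) {x : E} (hx : x ∉ C) :
    hitGenFun P C r x = r * ∫⁻ y, hitGenFun P C r y ∂(P x) :=
  MarkovQuasiCompact.hitGenFun_of_notMem hC hr₁ (one_le_coe_weight w)
    (fun _ => ENNReal.coe_ne_top) h r hx

theorem mul_inv_le_one_of_le {r s : ℝ≥0∞} (h : r ≤ s) : r * s⁻¹ ≤ 1 :=
  (mul_le_mul' h le_rfl).trans (ENNReal.mul_inv_le_one s)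

/-- A function comparable to `w` which is contracted by `R` with the rate `r⁻¹`. -/
theorem exists_supersolution (hC : MeasurableSet C) (hr₁ : 1 < r₁) (hoff : DriftOff P C w r₁)
    (hon : DriftOn P C w r₁ η) (hRP : ∀ x, R x ≤ P x)
    (hRC : ∀ x ∈ C, R x = (1 - (b : ℝ≥0∞)) • P₀ x) {r : ℝ≥0∞} (hr : r ≤ r₁)
    (hh : returnGenFun P P₀ C r < (1 - (b : ℝ≥0∞))⁻¹) :
    ∃ (φ : E → ℝ≥0∞) (c : ℝ≥0), (∀ x, w x ≤ φ x) ∧ (∀ x, φ x ≤ (1 + c : ℝ≥0) * w x) ∧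
      ∀ x, r * ∫⁻ y, φ y ∂(R x) ≤ φ x := by
  have hrtop : r ≠ ∞ := (lt_of_le_of_lt hr ENNReal.coe_lt_top).ne
  obtain ⟨q, hq1, hq⟩ : ∃ q : ℝ≥0, q < 1 ∧ (1 - (b : ℝ≥0∞)) * returnGenFun P P₀ C r = q := by
    have hlt : (1 - (b : ℝ≥0∞)) * returnGenFun P P₀ C r < 1 := by
      rw [mul_comm]
      refine ENNReal.mul_lt_of_lt_div ?_
      rwa [one_div]
    exact ⟨((1 - (b : ℝ≥0∞)) * returnGenFun P P₀ C r).toNNReal, by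
      rw [← ENNReal.coe_lt_coe, ENNReal.coe_toNNReal (hlt.trans ENNReal.one_lt_top).ne]
      exact_mod_cast hlt, (ENNReal.coe_toNNReal (hlt.trans ENNReal.one_lt_top).ne).symm⟩
  -- The solution of `η + c q = c`: on `C`, `r R w ≤ η`, `r R u ≤ q` and `u = 1`, so `r R (w + c u)
  -- ≤ c ≤ w + c u`. Off `C` the two terms are bounded separately.
  set c : ℝ≥0 := η / (1 - q) with hc
  have hcq : η + c * q = c := by
    have h1 : 1 - q ≠ 0 := (tsub_pos_of_lt hq1).ne'
    have h2 : c * (1 - q) = η := div_mul_cancel₀ _ h1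
    calc η + c * q = c * (1 - q) + c * q := by rw [h2]
      _ = c * (1 - q + q) := by ring
      _ = c := by rw [tsub_add_cancel_of_le hq1.le, mul_one]
  set u := hitGenFun P C r with hu
  have huw : ∀ x, u x ≤ w x := hoff.hitGenFun_le hC hr₁ hr
  have hwmeas : Measurable fun y => (w y : ℝ≥0∞) := w.measurable'.coe_nnreal_ennreal
  have hsplit : ∀ x, ∫⁻ y, (w y + c * u y) ∂(R x) = ∫⁻ y, (w y : ℝ≥0∞) ∂(R x)
      + c * ∫⁻ y, u y ∂(R x) := fun x => by
    rw [lintegral_add_left hwmeas, lintegral_const_mul' _ _ ENNReal.coe_ne_top]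
  refine ⟨fun x => w x + c * u x, c, fun x => le_self_add, fun x => ?_, fun x => ?_⟩
  · calc (w x : ℝ≥0∞) + c * u x ≤ w x + c * w x := by gcongr; exact huw x
      _ = (1 + c : ℝ≥0) * w x := by push_cast; ring
  · rw [hsplit, mul_add]
    have hmono : ∀ f : E → ℝ≥0∞, ∫⁻ y, f y ∂(R x) ≤ ∫⁻ y, f y ∂(P x) := fun f =>
      lintegral_mono' (hRP x) le_rfl
    by_cases hx : x ∈ C
    · have h1 : r * ∫⁻ y, (w y : ℝ≥0∞) ∂(R x) ≤ η := by
        calc r * ∫⁻ y, (w y : ℝ≥0∞) ∂(R x) ≤ r * ((r₁ : ℝ≥0∞)⁻¹ * η) := by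
              gcongr
              exact (hmono _).trans (hon x hx)
          _ = r * (r₁ : ℝ≥0∞)⁻¹ * η := by ring
          _ ≤ 1 * η := by gcongr; exact mul_inv_le_one_of_le hr
          _ = η := one_mul _
      have h2 : r * (c * ∫⁻ y, u y ∂(R x)) ≤ c * q := by
        rw [hRC x hx, lintegral_smul_measure, smul_eq_mul]
        calc r * (c * ((1 - (b : ℝ≥0∞)) * ∫⁻ y, u y ∂(P₀ x)))
            = c * ((1 - (b : ℝ≥0∞)) * ∫⁻ y, r * u y ∂(P₀ x)) := by
              rw [lintegral_const_mul' _ _ hrtop]; ring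
          _ ≤ c * ((1 - (b : ℝ≥0∞)) * returnGenFun P P₀ C r) := by
              gcongr
              exact le_iSup₂ (f := fun x (_ : x ∈ C) => ∫⁻ y, r * hitGenFun P C r y ∂(P₀ x)) x hx
          _ = c * q := by rw [hq]
      calc r * ∫⁻ y, (w y : ℝ≥0∞) ∂(R x) + r * (c * ∫⁻ y, u y ∂(R x)) ≤ η + c * q :=
            add_le_add h1 h2
        _ = c := by exact_mod_cast hcq
        _ = c * u x := by rw [hu, hitGenFun_of_mem hC r hx, mul_one]
        _ ≤ w x + c * u x := le_add_self
    · have h1 : r * ∫⁻ y, (w y : ℝ≥0∞) ∂(R x) ≤ w x := by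
        calc r * ∫⁻ y, (w y : ℝ≥0∞) ∂(R x) ≤ r * ((r₁ : ℝ≥0∞)⁻¹ * w x) := by
              gcongr
              exact (hmono _).trans (hoff x hx)
          _ = r * (r₁ : ℝ≥0∞)⁻¹ * w x := by ring
          _ ≤ 1 * w x := by gcongr; exact mul_inv_le_one_of_le hr
          _ = w x := one_mul _
      have h2 : r * (c * ∫⁻ y, u y ∂(R x)) ≤ c * u x := by
        calc r * (c * ∫⁻ y, u y ∂(R x)) ≤ r * (c * ∫⁻ y, u y ∂(P x)) :=
              mul_le_mul' le_rfl (mul_le_mul' le_rfl (hmono _))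
          _ = c * (r * ∫⁻ y, u y ∂(P x)) := by ring
          _ = c * u x := by rw [hu, ← hoff.hitGenFun_of_notMem hC hr₁ r hx]
      exact add_le_add h1 h2

/-- From `c₀ ≤ κ r` follows `c₀ Rφ ≤ κ φ`, so the iterates are dominated by `κ^n φ`; comparability
of `φ` with `w` then gives the operator norm. -/
theorem norm_pow_le_of_supersolution {χ : E × E → ℂ}
    {T : WeightedSpace w →L[ℂ] WeightedSpace w} (hT : IsKernelOperator R χ T) {c₀ c κ r : ℝ≥0}
    (hc₀ : ∀ p, ‖χ p‖ ≤ c₀) (hκ : c₀ ≤ κ * r) {φ : E → ℝ≥0∞} (hwφ : ∀ x, w x ≤ φ x)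
    (hφw : ∀ x, φ x ≤ (1 + c : ℝ≥0) * w x) (hφ : ∀ x, r * ∫⁻ y, φ y ∂(R x) ≤ φ x) (n : ℕ) :
    ‖T ^ n‖ ≤ (1 + c : ℝ≥0) * (κ : ℝ) ^ n := by
  have hpow := hT.enorm_pow_apply_le hc₀ (φ := fun n x => (κ : ℝ≥0∞) ^ n * φ x)
    (fun x => by simpa using hwφ x) (fun n x => by
      rw [lintegral_const_mul' _ _ (ENNReal.pow_ne_top ENNReal.coe_ne_top)]
      have hκ' : (c₀ : ℝ≥0∞) ≤ κ * r := by exact_mod_cast hκ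
      calc (c₀ : ℝ≥0∞) * (κ ^ n * ∫⁻ y, φ y ∂(R x))
          ≤ (κ * r) * (κ ^ n * ∫⁻ y, φ y ∂(R x)) := by gcongr
        _ = κ ^ (n + 1) * (r * ∫⁻ y, φ y ∂(R x)) := by ring
        _ ≤ κ ^ (n + 1) * φ x := by gcongr; exact hφ x)
  have h := opNorm_le_of_enorm_apply_le (T := T ^ n) (M := (1 + c) * κ ^ n) fun f x =>
    (hpow f n x).trans (mul_le_mul' le_rfl (by
      calc (κ : ℝ≥0∞) ^ n * φ x ≤ κ ^ n * ((1 + c : ℝ≥0) * w x) := by gcongr; exact hφw x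
        _ = ((1 + c) * κ ^ n : ℝ≥0) * w x := by push_cast; ring))
  exact_mod_cast h

/-- Since `E_y[r₁^σ_C] ≤ w(y)`, for `b < 1` it is enough to integrate `w` against `P₀ ≤ (1-b)⁻¹ P`
on `C`, where the drift bounds `Pw` by a constant. For `b = 1` the value at each point of `C` is
exactly `r₁`. -/
theorem returnGenFun_lt_top (hC : MeasurableSet C) (hr₁ : 1 < r₁) (hb : b ≤ 1)
    (hoff : DriftOff P C w r₁) (hon : DriftOn P C w r₁ η)
    (hlt : b < 1 → ∀ x ∈ C, P₀ x ≤ (1 - (b : ℝ≥0∞))⁻¹ • P x)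
    (heq : b = 1 → ∀ x ∈ C, P₀ x = Measure.dirac x) : returnGenFun P P₀ C r₁ < ∞ := by
  have hwmeas : Measurable fun y => (w y : ℝ≥0∞) := w.measurable'.coe_nnreal_ennreal
  rcases hb.lt_or_eq with h | h
  · have hb0 : (1 - (b : ℝ≥0∞)) ≠ 0 := by
      have : (b : ℝ≥0∞) < 1 := by exact_mod_cast h
      exact (tsub_pos_of_lt this).ne'
    refine lt_of_le_of_lt (b := (r₁ : ℝ≥0∞) * ((1 - (b : ℝ≥0∞))⁻¹ * ((r₁ : ℝ≥0∞)⁻¹ * η)))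
      (iSup₂_le fun x hx => ?_) ?_
    · calc ∫⁻ y, r₁ * hitGenFun P C r₁ y ∂(P₀ x)
          ≤ ∫⁻ y, (r₁ : ℝ≥0∞) * w y ∂((1 - (b : ℝ≥0∞))⁻¹ • P x) := by
            refine lintegral_mono' (hlt h x hx) fun y => ?_
            gcongr
            exact hoff.hitGenFun_le hC hr₁ le_rfl y
        _ = r₁ * ((1 - (b : ℝ≥0∞))⁻¹ * ∫⁻ y, (w y : ℝ≥0∞) ∂(P x)) := by
            rw [lintegral_const_mul _ hwmeas, lintegral_smul_measure, smul_eq_mul]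
        _ ≤ _ := by gcongr; exact hon x hx
    · have hr0 : (r₁ : ℝ≥0∞) ≠ 0 := by
        have : r₁ ≠ 0 := (zero_lt_one.trans hr₁).ne'
        exact_mod_cast this
      refine ENNReal.mul_lt_top ENNReal.coe_lt_top (ENNReal.mul_lt_top ?_
        (ENNReal.mul_lt_top ?_ ENNReal.coe_lt_top))
      · exact (ENNReal.inv_ne_top.2 hb0).lt_top
      · exact (ENNReal.inv_ne_top.2 hr0).lt_top
  · refine lt_of_le_of_lt (b := (r₁ : ℝ≥0∞)) (iSup₂_le fun x hx => ?_) ENNReal.coe_lt_top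
    have hle : ∀ y, hitGenFun P C r₁ y ≤ w y := hoff.hitGenFun_le hC hr₁ le_rfl
    -- Integrating against a Dirac mass requires this, as singletons need not be measurable.
    have hmeas : Measurable (hitGenFun P C r₁) := by
      have h1 : hitGenFun P C r₁
          = fun x => ∑' n, (r₁ : ℝ≥0∞) ^ n * (avoidOp P C)^[n] (C.indicator 1) x :=
        funext fun x => hitGenFun_eq_tsum hC hr₁ (one_le_coe_weight w)
          (fun _ => ENNReal.coe_ne_top) hoff r₁ x
      rw [h1]
      exact Measurable.tsum fun n =>
        (measurable_iterate_avoidOp hC (measurable_one.indicator hC) n).const_mul _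
    rw [heq h x hx, lintegral_dirac' _ (hmeas.const_mul _), hitGenFun_of_mem hC _ hx, mul_one]

theorem hitGenFun_one_le (x : E) : hitGenFun P C 1 x ≤ 1 := by
  calc hitGenFun P C 1 x ≤ ∫⁻ _, 1 ∂(chainLaw P x) := by
        refine lintegral_mono fun ω => ?_
        induction hitTime C ω with
        | top => simp [powTop]
        | coe n => simp [powTop]
    _ = 1 := by rw [lintegral_one, measure_univ]

theorem pow_convex_le (t s : ℝ≥0) (ht : t ≤ 1) (n : ℕ) :
    (1 - t + t * s) ^ n ≤ 1 + t * s ^ n := by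
  have h := (convexOn_pow (𝕜 := ℝ) n).2 (Set.mem_Ici.2 zero_le_one) (Set.mem_Ici.2 s.coe_nonneg)
    (sub_nonneg.2 (NNReal.coe_le_one.2 ht)) t.coe_nonneg (sub_add_cancel _ _)
  simp only [smul_eq_mul, mul_one, one_pow] at h
  have h2 : ((1 - t + t * s : ℝ≥0) : ℝ) = 1 - t + t * s := by
    push_cast [NNReal.coe_sub ht]; ring
  rw [← NNReal.coe_le_coe]
  push_cast [NNReal.coe_sub ht]
  linarith [t.coe_nonneg]

/-- Convexity gives `r^(n+1) ≤ 1 + t r₁^(n+1)` for `r = 1 - t + t r₁`; sum over the law of `σ_C`.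
This takes the place of continuity of `h` at `1`. -/
theorem returnGenFun_convex_le [IsMarkovKernel P₀] (hC : MeasurableSet C) (hr₁ : 1 < r₁)
    (hoff : DriftOff P C w r₁) {t : ℝ≥0} (ht : t ≤ 1) :
    returnGenFun P P₀ C ((1 - t + t * r₁ : ℝ≥0) : ℝ≥0∞) ≤ 1 + t * returnGenFun P P₀ C r₁ := by
  set r : ℝ≥0 := 1 - t + t * r₁ with hr
  have hpt : ∀ y, r * hitGenFun P C r y ≤ 1 + t * (r₁ * hitGenFun P C r₁ y) := by
    intro y
    have htsum : ∀ r, hitGenFun P C r y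
        = ∑' n, r ^ n * (avoidOp P C)^[n] (C.indicator 1) y := fun r =>
      hitGenFun_eq_tsum hC hr₁ (one_le_coe_weight w) (fun _ => ENNReal.coe_ne_top) hoff r y
    calc r * hitGenFun P C r y
        ≤ hitGenFun P C 1 y + t * (r₁ * hitGenFun P C r₁ y) := by
          rw [htsum, htsum, htsum, ← ENNReal.tsum_mul_left, ← ENNReal.tsum_mul_left,
            ← ENNReal.tsum_mul_left, ← ENNReal.tsum_add]
          refine ENNReal.tsum_le_tsum fun n => ?_
          have h : (r : ℝ≥0∞) ^ (n + 1) ≤ 1 + t * (r₁ : ℝ≥0∞) ^ (n + 1) := by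
            exact_mod_cast pow_convex_le t r₁ ht (n + 1)
          calc (r : ℝ≥0∞) * (r ^ n * (avoidOp P C)^[n] (C.indicator 1) y)
              = r ^ (n + 1) * (avoidOp P C)^[n] (C.indicator 1) y := by ring
            _ ≤ (1 + t * (r₁ : ℝ≥0∞) ^ (n + 1)) * (avoidOp P C)^[n] (C.indicator 1) y := by gcongr
            _ = _ := by rw [one_pow]; ring
      _ ≤ _ := by gcongr; exact hitGenFun_one_le y
  refine iSup₂_le fun x hx => ?_
  calc ∫⁻ y, r * hitGenFun P C r y ∂(P₀ x)
      ≤ ∫⁻ y, 1 + t * (r₁ * hitGenFun P C r₁ y) ∂(P₀ x) := lintegral_mono hpt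
    _ = 1 + t * ∫⁻ y, r₁ * hitGenFun P C r₁ y ∂(P₀ x) := by
        rw [lintegral_add_left measurable_const, lintegral_one, measure_univ,
          lintegral_const_mul' _ _ ENNReal.coe_ne_top]
    _ ≤ _ := by
        gcongr
        exact le_iSup₂ (f := fun x (_ : x ∈ C) => ∫⁻ y, r₁ * hitGenFun P C r₁ y ∂(P₀ x)) x hx

theorem one_lt_rateRadius [IsMarkovKernel P₀] (hC : MeasurableSet C) (hr₁ : 1 < r₁)
    (hb_pos : 0 < b) (hoff : DriftOff P C w r₁)
    (hfin : returnGenFun P P₀ C r₁ < ∞) : 1 < rateRadius P P₀ C b r₁ := by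
  have hinv : (1 : ℝ≥0∞) < (1 - (b : ℝ≥0∞))⁻¹ := by
    rw [ENNReal.one_lt_inv]
    exact ENNReal.sub_lt_self ENNReal.one_ne_top one_ne_zero (by exact_mod_cast hb_pos.ne')
  obtain ⟨ε, hε, hε1⟩ := ENNReal.lt_iff_exists_add_pos_lt.1 hinv
  obtain ⟨h, hh⟩ : ∃ h : ℝ≥0, (h : ℝ≥0∞) = returnGenFun P P₀ C r₁ :=
    ⟨_, ENNReal.coe_toNNReal hfin.ne⟩
  -- Small enough that `1 + t h(r₁) ≤ 1 + ε < 1/(1-b)`; the cap at `1` keeps `1 - t + t r₁` below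
  -- `r₁`, and the `+ 1` avoids dividing by zero.
  set t : ℝ≥0 := min 1 (ε / (h + 1)) with ht
  have ht0 : 0 < t := lt_min one_pos (div_pos hε (by positivity))
  have ht1 : t ≤ 1 := min_le_left _ _
  have hth : t * h ≤ ε := by
    calc t * h ≤ ε / (h + 1) * (h + 1) := by
          gcongr
          · exact min_le_right _ _
          · exact le_self_add
      _ = ε := div_mul_cancel₀ _ (by positivity)
  have hr : 1 < 1 - t + t * r₁ := by
    calc 1 = 1 - t + t * 1 := by rw [mul_one, tsub_add_cancel_of_le ht1]
      _ < 1 - t + t * r₁ := by gcongr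
  have hrr₁ : 1 - t + t * r₁ ≤ r₁ := by
    calc 1 - t + t * r₁ ≤ (1 - t) * r₁ + t * r₁ := by
          gcongr
          exact le_mul_of_one_le_right' hr₁.le
      _ = (1 - t + t) * r₁ := by ring
      _ = r₁ := by rw [tsub_add_cancel_of_le ht1, one_mul]
  refine lt_of_lt_of_le (b := ((1 - t + t * r₁ : ℝ≥0) : ℝ≥0∞)) (by exact_mod_cast hr)
    (le_sSup ⟨by exact_mod_cast hrr₁, ?_⟩)
  refine lt_of_le_of_lt (returnGenFun_convex_le hC hr₁ hoff ht1) (lt_of_le_of_lt ?_ hε1)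
  rw [← hh]
  gcongr
  exact_mod_cast hth

/-- The supremum `r_b` need not be attained, so an admissible `r > c₀/ρ` is chosen below it, and
then `κ` strictly between `c₀/r` and `ρ`; strictness makes `κ` positive. -/
theorem exists_rate_of_lt (hr₁ : 1 < rateRadius P P₀ C b r₁) {c₀ ρ : ℝ≥0}
    (hρ : c₀ * (rateRadius P P₀ C b r₁)⁻¹ < ρ) :
    ∃ r κ : ℝ≥0, (r : ℝ≥0∞) ≤ r₁ ∧ returnGenFun P P₀ C r < (1 - (b : ℝ≥0∞))⁻¹ ∧ 0 < κ ∧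
      κ < ρ ∧ c₀ ≤ κ * r := by
  have hρ0 : ρ ≠ 0 := by
    rintro rfl
    exact absurd hρ (by simp)
  have hrtop : rateRadius P P₀ C b r₁ ≠ ∞ :=
    (lt_of_le_of_lt (sSup_le fun r hr => hr.1) ENNReal.coe_lt_top).ne
  have hr0 : rateRadius P P₀ C b r₁ ≠ 0 := (zero_lt_one.trans hr₁).ne'
  have hlt : (c₀ : ℝ≥0∞) / ρ < rateRadius P P₀ C b r₁ := by
    rw [← div_eq_mul_inv] at hρ
    rw [ENNReal.div_lt_iff (Or.inl (by exact_mod_cast hρ0)) (Or.inl ENNReal.coe_ne_top), mul_comm]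
    rwa [ENNReal.div_lt_iff (Or.inl hr0) (Or.inl hrtop)] at hρ
  obtain ⟨r, ⟨hrr₁, hrh⟩, hr⟩ := lt_sSup_iff.1 hlt
  lift r to ℝ≥0 using (lt_of_le_of_lt hrr₁ ENNReal.coe_lt_top).ne
  have hr' : c₀ / ρ < r := by
    rw [← ENNReal.coe_div hρ0] at hr
    exact_mod_cast hr
  have hr0 : 0 < r := lt_of_le_of_lt zero_le hr'
  have hcr : c₀ / r < ρ := by
    rw [div_lt_iff₀ hr0, mul_comm]
    rwa [div_lt_iff₀ (pos_iff_ne_zero.2 hρ0)] at hr'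
  obtain ⟨κ, hκ, hκρ⟩ := exists_between hcr
  exact ⟨r, κ, hrr₁, hrh, lt_of_le_of_lt zero_le hκ, hκρ, ((div_lt_iff₀ hr0).1 hκ).le⟩

end Rate

/-! ### Essential spectral radius of the twisted kernel operators -/

section Main

variable {E : Type*} [MeasurableSpace E] {w : WeightFunction E} {C : Set E} {b r₁ η : ℝ≥0}
  {P R P₀ : Kernel E E} [IsMarkovKernel P] [IsFiniteKernel R]

/-- The abstract perturbation result applied to `T = TN + TR`: `TN` has approximable sandwiches
because of its density, and the powers of `TR` decay at a rate `κ < ρ` because of the supersolution.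
-/
theorem essSpectralRadius_le_rateRadius (hC : MeasurableSet C) (hr₁ : 1 < r₁)
    (hb : b ≤ 1) {ν : Measure E} [IsProbabilityMeasure ν] {α : E × E → ℝ≥0}
    (hα : α ∈ weightedDensities w ν) (hoff : DriftOff P C w r₁) (hon : DriftOn P C w r₁ η)
    (hdecomp : ∀ x, P x = densityKernel ν (minorant C b α) x + R x)
    (hRC : ∀ x ∈ C, R x = (1 - (b : ℝ≥0∞)) • P₀ x) {m : ℝ≥0}
    (hm : ∀ x, ∫⁻ y, (w y : ℝ≥0∞) ∂(P x) ≤ m * w x)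
    (hrate : 1 < rateRadius P P₀ C b r₁) {χ : E × E → ℂ} (hχ : Measurable χ) {c₀ : ℝ≥0}
    (hc₀ : ∀ p, ‖χ p‖ ≤ c₀) {T : WeightedSpace w →L[ℂ] WeightedSpace w}
    (hT : IsKernelOperator P χ T) :
    essSpectralRadius T ≤ c₀ * (rateRadius P P₀ C b r₁)⁻¹ := by
  set N := densityKernel ν (minorant C b α) with hN
  have hRP : ∀ x, R x ≤ P x := fun x => by
    rw [hdecomp x]; exact Measure.le_add_left le_rfl
  have hNP : ∀ x, N x ≤ P x := fun x => by
    rw [hdecomp x]; exact Measure.le_add_right le_rfl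
  have hNfin : IsFiniteKernel N :=
    ⟨⟨1, ENNReal.one_lt_top, fun x => (hNP x _).trans prob_le_one⟩⟩
  obtain ⟨TN, hTN⟩ := exists_isKernelOperator (w := w) N (m := m)
    (fun x => (lintegral_mono' (hNP x) le_rfl).trans (hm x)) hχ hc₀
  obtain ⟨TR, hTR⟩ := exists_isKernelOperator (w := w) R (m := m)
    (fun x => (lintegral_mono' (hRP x) le_rfl).trans (hm x)) hχ hc₀
  have hadd : T = TN + TR := by
    refine ContinuousLinearMap.ext fun f => WeightedSpace.ext_apply fun x => ?_
    have h1 : (TN + TR) f x = TN f x + TR f x := rfl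
    rw [h1, (hT f x).2, (hTN f x).2, (hTR f x).2, hdecomp x,
      integral_add_measure (hTN f x).1 (hTR f x).1]
  refine essSpectralRadius_le_of_forall_splitting fun ρ hρ => ?_
  obtain ⟨r, κ, hr, hh, hκ0, hκρ, hκ⟩ := exists_rate_of_lt hrate hρ
  obtain ⟨φ, c, hwφ, hφw, hφ⟩ := exists_supersolution hC hr₁ hoff hon hRP hRC hr hh
  rw [hadd]
  exact exists_isSpectralSplitting_add
    (isApproximable_mul_mul ν hα (measurable_minorant hC hα.1) (minorant_le hb) hχ hc₀ hTN)
    (by exact_mod_cast hκ0) (norm_pow_le_of_supersolution hTR hc₀ hκ hwφ hφw hφ)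
    (by exact_mod_cast hκρ)

end Main

end MarkovQuasiCompact

open MarkovQuasiCompact
theorem mainTheorem5 {E : Type*} [MeasurableSpace E]
    (P : Kernel E E) [IsMarkovKernel P]
    (C : Set E) (hC : MeasurableSet C) (hC_nonempty : C.Nonempty)
    (w : WeightFunction E) (r₁ η : ℝ≥0) (hr₁ : 1 < r₁)
    (drift : ∀ x, ∫⁻ y, (w y : ℝ≥0∞) ∂(P x) ≤
      (r₁ : ℝ≥0∞)⁻¹ * (w x * Cᶜ.indicator 1 x + η * C.indicator 1 x))
    (b : ℝ≥0) (hb_pos : 0 < b) (hb_le : b ≤ 1)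
    (ν : Measure E) [IsProbabilityMeasure ν]
    (α : E × E → ℝ≥0) (hα : α ∈ weightedDensities w ν)
    (hT : IsMarkovKernel (densityKernel ν α))
    (minorization : ∀ x, ∀ A, MeasurableSet A →
      b * C.indicator 1 x * densityKernel ν α x A ≤ P x A) :
    -- `P` is quasi-compact on `𝓑_w` with spectral radius `1`
    ∃ T : WeightedSpace w →L[ℂ] WeightedSpace w, IsKernelOperator P 1 T ∧
      IsQuasiCompact T ∧ spectralRadius ℂ T = 1 ∧
      -- the residual Markov kernel
      ∃ P₀ : Kernel E E, IsMarkovKernel P₀ ∧ IsResidualKernel P (densityKernel ν α) C b P₀ ∧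
        -- (i)
        returnGenFun P P₀ C r₁ < ∞ ∧ 1 < rateRadius P P₀ C b r₁ ∧
        -- (ii)
        essSpectralRadius T ≤ (rateRadius P P₀ C b r₁)⁻¹ ∧
        -- (iii)
        ∀ χ : E × E → ℂ, Measurable χ → (∃ M : ℝ, ∀ p, ‖χ p‖ ≤ M) →
          ∃ Tχ : WeightedSpace w →L[ℂ] WeightedSpace w, IsKernelOperator P χ Tχ ∧
            ((⨆ p, ‖χ p‖ₑ) * (rateRadius P P₀ C b r₁)⁻¹ < spectralRadius ℂ Tχ →
              IsQuasiCompact Tχ ∧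
              essSpectralRadius Tχ ≤ (⨆ p, ‖χ p‖ₑ) * (rateRadius P P₀ C b r₁)⁻¹) := by
  have hE : Nonempty E := ⟨hC_nonempty.some⟩
  have hoff : DriftOff P C w r₁ := fun x hx => by
    have h := drift x
    rwa [Set.indicator_of_mem (Set.mem_compl hx), Set.indicator_of_notMem hx, Pi.one_apply,
      mul_one, mul_zero, add_zero] at h
  have hon : DriftOn P C w r₁ η := fun x hx => by
    have h := drift x
    rwa [Set.indicator_of_notMem (fun h' : x ∈ Cᶜ => h' hx), Set.indicator_of_mem hx,
      Pi.one_apply, mul_one, mul_zero, zero_add] at h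
  have hdrift : ∀ x, ∫⁻ y, (w y : ℝ≥0∞) ∂(P x) ≤ (r₁ : ℝ≥0∞)⁻¹ * (w x + η) := fun x => by
    by_cases hx : x ∈ C
    · exact (hon x hx).trans (mul_le_mul' le_rfl le_add_self)
    · exact (hoff x hx).trans (mul_le_mul' le_rfl le_self_add)
  have hm : ∀ x, ∫⁻ y, (w y : ℝ≥0∞) ∂(P x) ≤ (1 + η : ℝ≥0) * w x := fun x => by
    have hr : (r₁ : ℝ≥0∞)⁻¹ ≤ 1 := ENNReal.inv_le_one.2 (by exact_mod_cast hr₁.le)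
    calc ∫⁻ y, (w y : ℝ≥0∞) ∂(P x) ≤ (r₁ : ℝ≥0∞)⁻¹ * (w x + η) := hdrift x
      _ ≤ 1 * (1 * w x + η * w x) := by
          rw [one_mul (w x : ℝ≥0∞)]
          gcongr
          exact le_mul_of_one_le_right' (one_le_coe_weight w x)
      _ = (1 + η : ℝ≥0) * w x := by push_cast; ring
  have hN : ∀ x A, MeasurableSet A → densityKernel ν (minorant C b α) x A
      = b * C.indicator 1 x * densityKernel ν α x A := fun x A hA =>
    densityKernel_minorant_apply hC hα.1 x hA
  have hle : ∀ x, densityKernel ν (minorant C b α) x ≤ P x := fun x =>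
    Measure.le_iff.2 fun A hA => by rw [hN x A hA]; exact minorization x A hA
  obtain ⟨R, P₀, hRfin, hdecomp, hP₀, hres, hRC, hlt, heq⟩ :=
    exists_residualKernel P (densityKernel ν α) hC hb_le hN hle
  obtain ⟨T, hT1⟩ := exists_isKernelOperator (w := w) P hm (χ := 1) (c := 1) measurable_one
    (fun p => by simp)
  have hrad : spectralRadius ℂ T = 1 := spectralRadius_eq_one hr₁ hdrift hT1
  have hfin : returnGenFun P P₀ C r₁ < ∞ := returnGenFun_lt_top hC hr₁ hb_le hoff hon hlt heq
  have hrate : 1 < rateRadius P P₀ C b r₁ := one_lt_rateRadius hC hr₁ hb_pos hoff hfin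
  have hess : essSpectralRadius T ≤ (rateRadius P P₀ C b r₁)⁻¹ := by
    have h := essSpectralRadius_le_rateRadius hC hr₁ hb_le hα hoff hon hdecomp hRC hm hrate
      measurable_one (c₀ := 1) (fun p => by simp) hT1
    rwa [ENNReal.coe_one, one_mul] at h
  refine ⟨T, hT1, ?_, hrad, P₀, hP₀, hres, hfin, hrate, hess, fun χ hχ hM => ?_⟩
  · refine lt_of_le_of_lt hess ?_
    rw [hrad]
    exact ENNReal.inv_lt_one.2 hrate
  · obtain ⟨M, hM⟩ := hM
    have hM' : ∀ p, ‖χ p‖ₑ ≤ M.toNNReal := fun p => by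
      have : ‖χ p‖₊ ≤ M.toNNReal := by
        rw [← norm_toNNReal]
        exact Real.toNNReal_le_toNNReal (hM p)
      exact ENNReal.coe_le_coe.2 this
    -- The bound must be the exact supremum of `|χ|`, not the given `M`, since it enters the
    -- conclusion.
    obtain ⟨c₀, hc₀⟩ : ∃ c₀ : ℝ≥0, (c₀ : ℝ≥0∞) = ⨆ p, ‖χ p‖ₑ :=
      ⟨_, ENNReal.coe_toNNReal (lt_of_le_of_lt (iSup_le hM') ENNReal.coe_lt_top).ne⟩
    have hχc : ∀ p, ‖χ p‖ ≤ c₀ := fun p => by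
      have h1 : ‖χ p‖ₑ ≤ c₀ := by rw [hc₀]; exact le_iSup (fun p => ‖χ p‖ₑ) p
      have h2 : ‖χ p‖₊ ≤ c₀ := ENNReal.coe_le_coe.1 h1
      exact h2
    obtain ⟨Tχ, hTχ⟩ := exists_isKernelOperator (w := w) P hm hχ hχc
    have hessχ := essSpectralRadius_le_rateRadius hC hr₁ hb_le hα hoff hon hdecomp hRC hm hrate
      hχ hχc hTχ
    rw [hc₀] at hessχ
    exact ⟨Tχ, hTχ, fun h => ⟨lt_of_le_of_lt hessχ h, hessχ⟩⟩
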